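/- Let $q$ be a prime power with $4\mid q+1$ and $3\mid q-1$, and let $G=\operatorname{PGL}_2(q)$. Then there is a homomorphism $\varphi\colon G\to\operatorname{Sp}_{q+1}(2)$ which, as a representation of degree $q+1$ over $\mathbb{F}_2$, is absolutely irreducible (it stays irreducible over every extension field of $\mathbb{F}_2$) and unisingular, that is, $\det(\varphi(g)-1)=0$ for all $g\in G$. Moreover, $\varphi$ can be chosen so that the following holds. Let $L=\operatorname{PSL}_2(q)\le G$ and let $B\le L$ be the Borel subgroup, the image of the upper triangular matrices of $\operatorname{SL}_2(q)$. There is a one-dimensional character $\tau\colon B\to\mathbb{C}^\times$ of order $3$ such that the induced character $\tau^L$ is an irreducible complex character of $L$ of $2$-defect zero (its degree is divisible by the $2$-part of $|L|$), and the Brauer character of $\varphi|_L$ agrees with $\tau^L$ on all elements of $L$ of odd order. (Here Brauer characters may be computed with respect to any embedding $\theta\colon\overline{\mathbb{F}}_2^{\,\times}\hookrightarrow\mathbb{C}^\times$.) -/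

import Mathlib

namespace Unisingular

universe u

variable {G : Type*} [Group G]

section MatrixRepresentations

variable {ι : Type*} [Fintype ι] [DecidableEq ι] {k : Type u} [Field k]

/-- The linear representation on column vectors `ι → k` afforded by a matrix representation. -/
noncomputable def toRepresentation (ρ : G →* Matrix ι ι k) : Representation k G (ι → k) :=
  ((Matrix.toLinAlgEquiv' : Matrix ι ι k ≃ₐ[k] ((ι → k) →ₗ[k] (ι → k))) :
    Matrix ι ι k →* ((ι → k) →ₗ[k] (ι → k))).comp ρ

/-- Extension of scalars of a matrix representation along `k → K`. -/
def baseChange (K : Type*) [Field K] [Algebra k K] (ρ : G →* Matrix ι ι k) :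
    G →* Matrix ι ι K :=
  ((algebraMap k K).mapMatrix : Matrix ι ι k →+* Matrix ι ι K).toMonoidHom.comp ρ

/-- A matrix representation over `k` is absolutely irreducible if it remains irreducible over every
extension field of `k` (the algebraic closure of `k` is among the fields `K`). -/
def IsAbsolutelyIrreducible (ρ : G →* Matrix ι ι k) : Prop :=
  ∀ (K : Type u) [Field K] [Algebra k K], (toRepresentation (baseChange K ρ)).IsIrreducible

/-- `ρ` is unisingular if `det (ρ g - 1) = 0` for every `g`. -/
def IsUnisingular (ρ : G →* Matrix ι ι k) : Prop :=
  ∀ g : G, (ρ g - 1).det = 0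

/-- The value at `g` of the Brauer character of `ρ`: the sum, with multiplicity, of the lifts
`θ x ∈ ℂ` of the eigenvalues `x` of `ρ g` in the algebraic closure of `k`. It is meant for `k` of
positive characteristic `p`, for `g` of order prime to `p`, and for an injective `θ`, that is, for
an embedding of the multiplicative group of the algebraic closure in that of `ℂ`, extended by
`θ 0 = 0`. -/
noncomputable def brauerCharacter (θ : AlgebraicClosure k →*₀ ℂ) (ρ : G →* Matrix ι ι k) (g : G) :
    ℂ :=
  ((baseChange (AlgebraicClosure k) ρ g).charpoly.roots.map θ).sum

end MatrixRepresentations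

section OrdinaryCharacters

open scoped Classical in
/-- The character of the finite group `G` induced from the one-dimensional character `τ` of the
subgroup `B`: `τ^G(g) = |B|⁻¹ ∑_{x ∈ G, x⁻¹ g x ∈ B} τ(x⁻¹ g x)`. -/
noncomputable def inducedCharacter (B : Subgroup G) (τ : B →* ℂˣ) (g : G) : ℂ :=
  (Nat.card B : ℂ)⁻¹ *
    ∑ᶠ x : G, if h : x⁻¹ * g * x ∈ B then (τ ⟨x⁻¹ * g * x, h⟩ : ℂ) else 0

/-- `χ` is the character of an irreducible complex representation of degree `n`. -/
def IsIrreducibleCharacterOfDegree (χ : G → ℂ) (n : ℕ) : Prop :=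
  ∃ ρ : Representation ℂ G (Fin n → ℂ), ρ.IsIrreducible ∧ ∀ g, ρ.character g = χ g

/-- An irreducible character `χ` of the finite group `G` has `p`-defect zero if its degree is
divisible by the `p`-part `|G|_p` of the order of `G`. -/
def IsDefectZeroCharacter (p : ℕ) (χ : G → ℂ) : Prop :=
  ∃ n : ℕ, IsIrreducibleCharacterOfDegree χ n ∧ p ^ (Nat.card G).factorization p ∣ n

end OrdinaryCharacters

section Borel

variable (F : Type*) [Field F]

/-- The upper triangular matrices of determinant one, a Borel subgroup of `SL_2(F)`. -/
def borelSL : Subgroup (Matrix.SpecialLinearGroup (Fin 2) F) where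
  carrier := {s | s 1 0 = 0}
  one_mem' := by simp
  mul_mem' := by
    intro a b ha hb
    simp only [Set.mem_ofPred_eq] at *
    simp [Matrix.mul_apply, Fin.sum_univ_two, ha, hb]
  inv_mem' := by
    intro a ha
    simp only [Set.mem_ofPred_eq] at *
    simp [Matrix.SpecialLinearGroup.coe_inv, Matrix.adjugate_fin_two, ha]

/-- The Borel subgroup of `L_2(F) = PSL_2(F)`: the image of the upper triangular matrices. -/
def borelPSL : Subgroup (Matrix.ProjectiveSpecialLinearGroup (Fin 2) F) :=
  (borelSL F).map (QuotientGroup.mk' _)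

end Borel

end Unisingular

/-!
Let `ω` be a character of order three of `Fˣ`, with values in a field `K`. The functions `f` on `F²`
with `f (a v) = ω a * f v` form a space of dimension `q + 1`, on which `GL₂(F)` acts by
`(g f)(v) = ω (det g)⁻¹ f (g⁻¹ v)`. Because `ω ^ 3 = 1` the scalars act trivially, so this is a
representation of `PGL₂(F)`, written here as a monomial matrix representation `principalSeries ω`
indexed by the points `Option F` of the projective line. It is defined for every `K`, compatibly
with homomorphisms, and the required representation and the complex character `τ^L` are both
instances of it.

* Irreducibility (`exists_principalSeries_coeff_ne_zero`) holds, already for `SL₂(F)`, whenever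
  `q ≠ 0` in `K`: average a vector over the unipotent matrices, then separate two coordinates by the
  torus. It is phrased through matrix coefficients, so that it descends to subfields.
* Every `g` has a fixed vector (`det_principalSeries_sub_one`): the group generated by a nonscalar
  `g` acts freely on the orbit of a line that is not an eigenline of `g`.
* The operator `T f (v) = ∑ ω (det (v, w)) f w` intertwines the principal series of `ω⁻¹` and `ω`,
  and the operators for `ω` and `ω⁻¹` are inverse to each other up to the factor `q`
  (`intertwiner_mul_inv`, a Jacobi sum). For `K = 𝔽₄` conjugation turns `ω` into `ω⁻¹`, and
  `f ↦ T f̄` is a conjugate-linear involution commuting with the group. Its fixed vectors are an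
  `𝔽₂`-form, and on them the form given by the conjugate of `T` is alternating, nondegenerate and
  invariant (`exists_symplectic_descent`). This is the representation `φ`.
* For elements of odd order the sum of the lifted eigenvalues of a matrix with entries zero or roots
  of unity is the trace of the lifted matrix (`sum_map_roots_charpoly_eq_trace`), since the
  characteristic polynomial factors over a cyclotomic ring of integers. Hence the Brauer character
  of `φ` is the character of the complex principal series, which is induced from the Borel subgroup
  (`inducedCharacter_eq_trace_of_monomial`). Replacing the cubic character by its inverse does not
  change it (`trace_principalSeries_inv`), which makes the choice of `θ` irrelevant.
* The Borel subgroup of `PSL₂(F)` has odd order because `-1` is not a square, so the degree `q + 1`,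
  which is its index, contains the full `2`-part of the group order.
-/

namespace Unisingular

open Matrix

/-! ### The principal series of a cubic character and its intertwining operator -/

section PrincipalSeries

variable {F : Type*} [Field F] {K : Type*} [Field K]

/-- The chosen representative of a point of the projective line over `F`, whose points are encoded
as `Option F`: the point at infinity `none` is the line of `(1, 0)` and `some x` is the line of
`(x, 1)`. -/
def lineRep : Option F → Fin 2 → F
  | none => ![1, 0]
  | some x => ![x, 1]

lemma lineRep_ne_zero (P : Option F) : lineRep P ≠ 0 := by
  intro h
  cases P with
  | none => simpa [lineRep] using congrFun h 0
  | some x => simpa [lineRep] using congrFun h 1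

lemma exists_smul_lineRep {v : Fin 2 → F} (hv : v ≠ 0) :
    ∃ (c : F) (P : Option F), c ≠ 0 ∧ v = c • lineRep P := by
  by_cases h : v 1 = 0
  · refine ⟨v 0, none, fun h0 => hv ?_, ?_⟩
    · ext i; fin_cases i <;> simp [h, h0]
    · ext i; fin_cases i <;> simp [lineRep, h]
  · refine ⟨v 1, some (v 0 / v 1), h, ?_⟩
    ext i; fin_cases i <;> simp [lineRep]; field_simp

lemma eq_of_smul_lineRep_eq {a b : F} {P Q : Option F} (ha : a ≠ 0)
    (h : a • lineRep P = b • lineRep Q) : P = Q ∧ a = b := by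
  have h0 := congrFun h 0
  have h1 := congrFun h 1
  cases P <;> cases Q <;> simp [lineRep] at h0 h1
  · exact ⟨rfl, h0⟩
  · exact absurd (by rw [h0, ← h1, zero_mul]) ha
  · exact absurd h1 ha
  · subst h1
    exact ⟨congrArg _ (mul_left_cancel₀ ha h0), rfl⟩

lemma mulChar_pow_three {ω : MulChar F K} (hω : ω ^ 3 = 1) {c : F} (hc : c ≠ 0) : ω c ^ 3 = 1 := by
  rw [← MulChar.pow_apply' ω three_ne_zero, hω, MulChar.one_apply hc.isUnit]

lemma inv_pow_three {ω : MulChar F K} (hω : ω ^ 3 = 1) : ω⁻¹ ^ 3 = 1 := by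
  rw [inv_pow, hω, inv_one]

/-- The matrix of the intertwining operator `f ↦ (v ↦ ∑ ω (det (v, w)) f w)`, the sum being over
the representatives `w` of the lines, from the principal series of `ω⁻¹` to that of `ω`. -/
def intertwiner (ω : MulChar F K) : Matrix (Option F) (Option F) K :=
  of fun P Q => ω (lineRep P 0 * lineRep Q 1 - lineRep P 1 * lineRep Q 0)

lemma intertwiner_transpose (ω : MulChar F K) (h : ω (-1) = 1) :
    (intertwiner ω)ᵀ = intertwiner ω := by
  ext P Q
  simp only [transpose_apply, intertwiner, of_apply]
  rw [← one_mul (ω (lineRep P 0 * _ - _)), ← h, ← map_mul]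
  congr 1; ring

lemma intertwiner_apply_self (ω : MulChar F K) (P : Option F) : intertwiner ω P P = 0 := by
  simp [intertwiner, mul_comm, MulChar.map_zero]

lemma intertwiner_map {K' : Type*} [Field K'] (ω : MulChar F K) (ω' : MulChar F K')
    {Φ : Type*} [FunLike Φ K K'] [MonoidWithZeroHomClass Φ K K'] (θ : Φ) (h : ∀ a, θ (ω a) = ω' a) :
    (intertwiner ω).map θ = intertwiner ω' := by
  ext P Q
  simp [intertwiner, h]

variable [DecidableEq F]

/-- If `v` spans the line `Q`, say `v = c • lineRep Q`, then this is `ω c`; otherwise it is `0`.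
As a function of `v` it is the function supported on `Q` with value `1` at `lineRep Q` which is
homogeneous with respect to `ω`. -/
def lineCoord (ω : MulChar F K) (v : Fin 2 → F) : Option F → K
  | none => if v 1 = 0 then ω (v 0) else 0
  | some x => if v 0 = x * v 1 then ω (v 1) else 0

lemma lineCoord_smul (ω : MulChar F K) (a : F) (v : Fin 2 → F) (Q : Option F) :
    lineCoord ω (a • v) Q = ω a * lineCoord ω v Q := by
  rcases eq_or_ne a 0 with rfl | ha
  · cases Q <;> simp [lineCoord, MulChar.map_zero]
  · cases Q <;> simp [lineCoord, ha, mul_left_comm _ a]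

lemma lineCoord_lineRep (ω : MulChar F K) (P Q : Option F) :
    lineCoord ω (lineRep P) Q = (1 : Matrix (Option F) (Option F) K) P Q := by
  cases P <;> cases Q <;> simp [lineCoord, lineRep, Matrix.one_apply]

lemma lineCoord_smul_lineRep (ω : MulChar F K) (a : F) (P Q : Option F) :
    lineCoord ω (a • lineRep P) Q = if P = Q then ω a else 0 := by
  rw [lineCoord_smul, lineCoord_lineRep, Matrix.one_apply, mul_ite, mul_one, mul_zero]

/-- A homogeneous function is determined by its values at the chosen representatives. -/
lemma sum_lineCoord_mul [Fintype F] (ω : MulChar F K) {f : (Fin 2 → F) → K}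
    (hf : ∀ a v, f (a • v) = ω a * f v) (v : Fin 2 → F) :
    ∑ Q, lineCoord ω v Q * f (lineRep Q) = f v := by
  rcases eq_or_ne v 0 with rfl | hv
  · have h0 : f 0 = 0 := by simpa [MulChar.map_zero] using hf 0 0
    have : ∀ Q, lineCoord ω 0 Q = 0 := fun Q => by
      simpa [MulChar.map_zero] using lineCoord_smul ω 0 0 Q
    simp [h0, this]
  · obtain ⟨c, P, hc, rfl⟩ := exists_smul_lineRep hv
    simp [lineCoord_smul_lineRep, hf]

/-- The entries of a principal series matrix and of its inverse transpose agree, up to inverting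
the character. -/
lemma lineCoord_inv_mulVec (ω : MulChar F K) (g : GL (Fin 2) F) (P Q : Option F) :
    lineCoord ω ((g⁻¹ : GL (Fin 2) F).1 *ᵥ lineRep P) Q = lineCoord ω⁻¹ (g.1 *ᵥ lineRep Q) P := by
  have hne : ∀ (h : GL (Fin 2) F) (R : Option F), h.1 *ᵥ lineRep R ≠ 0 := fun h R h0 => by
    have := congrArg (fun v => h.2 *ᵥ v) h0
    simp only [mulVec_mulVec, h.inv_val, one_mulVec, mulVec_zero] at this
    exact lineRep_ne_zero R this
  obtain ⟨c, R, hc, hR⟩ := exists_smul_lineRep (hne g⁻¹ P)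
  obtain ⟨d, S, hd, hS⟩ := exists_smul_lineRep (hne g Q)
  rw [hR, hS, lineCoord_smul_lineRep, lineCoord_smul_lineRep]
  have hP : lineRep P = c • (g.1 *ᵥ lineRep R) := by
    rw [← mulVec_smul, ← hR, mulVec_mulVec, ← Units.val_mul, mul_inv_cancel, Units.val_one,
      one_mulVec]
  have hQ : lineRep Q = d • ((g⁻¹ : GL (Fin 2) F).1 *ᵥ lineRep S) := by
    rw [← mulVec_smul, ← hS, mulVec_mulVec, ← Units.val_mul, inv_mul_cancel, Units.val_one,
      one_mulVec]
  by_cases h : R = Q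
  · subst h
    rw [hS, smul_smul] at hP
    obtain ⟨h1, h2⟩ := eq_of_smul_lineRep_eq one_ne_zero ((one_smul F _).trans hP)
    rw [if_pos rfl, if_pos h1.symm, MulChar.inv_apply', eq_inv_of_mul_eq_one_left h2.symm]
  · rw [if_neg h, if_neg]
    rintro rfl
    rw [hR, smul_smul] at hQ
    exact h (eq_of_smul_lineRep_eq one_ne_zero ((one_smul F _).trans hQ)).1.symm

variable [Fintype F]

/-- The twisted principal series of `GL₂(F)` attached to the character `ω`: the action
`(g f)(v) = ω (det g)⁻¹ f (g⁻¹ v)` on the functions `f` on `F²` with `f (a v) = ω a * f v`, in the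
basis of the functions supported on a line. -/
noncomputable def principalSeriesGL (ω : MulChar F K) :
    GL (Fin 2) F →* Matrix (Option F) (Option F) K where
  toFun g := of fun P Q => ω⁻¹ g.1.det * lineCoord ω ((g⁻¹ : GL (Fin 2) F).1 *ᵥ lineRep P) Q
  map_one' := by
    ext P Q
    simp [lineCoord_lineRep]
  map_mul' g h := by
    ext P R
    simp only [of_apply, mul_apply, Units.val_mul, det_mul, map_mul, _root_.mul_inv_rev]
    have := sum_lineCoord_mul ω (f := fun v => lineCoord ω ((h⁻¹ : GL (Fin 2) F).1 *ᵥ v) R)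
      (fun a v => by rw [mulVec_smul, lineCoord_smul]) ((g⁻¹ : GL (Fin 2) F).1 *ᵥ lineRep P)
    rw [← mulVec_mulVec, ← this, Finset.mul_sum]
    exact Finset.sum_congr rfl fun Q _ => by ring

lemma principalSeriesGL_apply (ω : MulChar F K) (g : GL (Fin 2) F) (P Q : Option F) :
    principalSeriesGL ω g P Q =
      ω⁻¹ g.1.det * lineCoord ω ((g⁻¹ : GL (Fin 2) F).1 *ᵥ lineRep P) Q := rfl

lemma principalSeriesGL_scalar {ω : MulChar F K} (hω : ω ^ 3 = 1) (c : Fˣ) :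
    principalSeriesGL ω (GeneralLinearGroup.scalar (Fin 2) c) = 1 := by
  ext P Q
  have h1 : (GeneralLinearGroup.scalar (Fin 2) c).1.det = c ^ 2 := by
    simp
  have h2 : ((GeneralLinearGroup.scalar (Fin 2) c)⁻¹ : GL (Fin 2) F).1 *ᵥ lineRep P =
      (c : F)⁻¹ • lineRep P := by
    rw [← map_inv]
    simp [GeneralLinearGroup.scalar]
  have h3 : ω⁻¹ ((c : F) ^ 2) * ω (c : F)⁻¹ = 1 := by
    have := mulChar_pow_three hω c.ne_zero
    rw [← MulChar.inv_apply' ω, MulChar.inv_apply_eq_inv', MulChar.inv_apply_eq_inv', map_pow,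
      ← mul_inv, ← pow_succ, this, inv_one]
  rw [principalSeriesGL_apply, h1, h2, lineCoord_smul, ← mul_assoc, h3, one_mul, lineCoord_lineRep]

/-- The twist by `det` makes the scalars act trivially when `ω ^ 3 = 1`, so that the principal
series is a representation of `PGL₂(F)`. -/
noncomputable def principalSeries (ω : MulChar F K) (hω : ω ^ 3 = 1) :
    ProjGenLinGroup (Fin 2) F →* Matrix (Option F) (Option F) K :=
  QuotientGroup.lift _ (principalSeriesGL ω) fun g hg => by
    rw [GeneralLinearGroup.center_eq_range_scalar] at hg
    obtain ⟨c, rfl⟩ := hg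
    exact principalSeriesGL_scalar hω c

lemma principalSeries_mk (ω : MulChar F K) (hω : ω ^ 3 = 1) (g : GL (Fin 2) F) :
    principalSeries ω hω (ProjGenLinGroup.mk g) = principalSeriesGL ω g := rfl

lemma principalSeries_transpose (ω : MulChar F K) (hω : ω ^ 3 = 1)
    (g : ProjGenLinGroup (Fin 2) F) :
    (principalSeries ω hω g)ᵀ = principalSeries ω⁻¹ (inv_pow_three hω) g⁻¹ := by
  induction g using ProjGenLinGroup.induction_on with | mk g =>
  ext Q P
  rw [← map_inv, principalSeries_mk, principalSeries_mk, transpose_apply, principalSeriesGL_apply,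
    principalSeriesGL_apply, inv_inv g, lineCoord_inv_mulVec, inv_inv ω]
  congr 1
  rw [MulChar.inv_apply', coe_units_inv, det_nonsing_inv, Ring.inverse_eq_inv']

lemma principalSeries_mul_intertwiner (ω : MulChar F K) (hω : ω ^ 3 = 1)
    (g : ProjGenLinGroup (Fin 2) F) :
    principalSeries ω hω g * intertwiner ω =
      intertwiner ω * principalSeries ω⁻¹ (inv_pow_three hω) g := by
  induction g using ProjGenLinGroup.induction_on with | mk g =>
  ext P R
  rw [principalSeries_mk, principalSeries_mk, mul_apply, mul_apply]
  simp only [principalSeriesGL_apply, lineCoord_inv_mulVec ω⁻¹, inv_inv, intertwiner, of_apply]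
  have h1 := sum_lineCoord_mul ω (f := fun v => ω (v 0 * lineRep R 1 - v 1 * lineRep R 0))
    (fun a v => by simp only [Pi.smul_apply, smul_eq_mul, ← map_mul]; congr 1; ring)
    ((g⁻¹ : GL (Fin 2) F).1 *ᵥ lineRep P)
  have h2 := sum_lineCoord_mul ω (f := fun v => ω (lineRep P 0 * v 1 - lineRep P 1 * v 0))
    (fun a v => by simp only [Pi.smul_apply, smul_eq_mul, ← map_mul]; congr 1; ring)
    (g.1 *ᵥ lineRep R)
  have h3 : ω⁻¹ g.1.det * (ω (((g⁻¹ : GL (Fin 2) F).1 *ᵥ lineRep P) 0 * lineRep R 1 -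
      ((g⁻¹ : GL (Fin 2) F).1 *ᵥ lineRep P) 1 * lineRep R 0)) =
      ω g.1.det * ω (lineRep P 0 * (g.1 *ᵥ lineRep R) 1 - lineRep P 1 * (g.1 *ᵥ lineRep R) 0) := by
    have hd : g.1.det ≠ 0 := g.det.ne_zero
    -- `det (g⁻¹ v, w) = (det g)⁻¹ det (v, g w)`, and `ω⁻² = ω`
    have : lineRep P 0 * (g.1 *ᵥ lineRep R) 1 - lineRep P 1 * (g.1 *ᵥ lineRep R) 0 =
        g.1.det * (((g⁻¹ : GL (Fin 2) F).1 *ᵥ lineRep P) 0 * lineRep R 1 -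
      ((g⁻¹ : GL (Fin 2) F).1 *ᵥ lineRep P) 1 * lineRep R 0) := by
      generalize lineRep R = w
      have hP : lineRep P = g.1 *ᵥ ((g⁻¹ : GL (Fin 2) F).1 *ᵥ lineRep P) := by
        rw [mulVec_mulVec, ← Units.val_mul, mul_inv_cancel, Units.val_one, one_mulVec]
      generalize (g⁻¹ : GL (Fin 2) F).1 *ᵥ lineRep P = u at *
      simp only [hP, mulVec, dotProduct, Fin.sum_univ_two, det_fin_two]
      ring
    rw [this, map_mul, ← mul_assoc]
    congr 1
    have := mulChar_pow_three hω hd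
    rw [MulChar.inv_apply_eq_inv', ← pow_two]
    exact inv_eq_of_mul_eq_one_right (by rw [← pow_succ', this])
  calc _ = ω⁻¹ g.1.det * (ω (((g⁻¹ : GL (Fin 2) F).1 *ᵥ lineRep P) 0 * lineRep R 1 -
      ((g⁻¹ : GL (Fin 2) F).1 *ᵥ lineRep P) 1 * lineRep R 0)) := by
        rw [← h1, Finset.mul_sum]
        exact Finset.sum_congr rfl fun Q _ => by ring
    _ = _ := h3
    _ = _ := by
        rw [← h2, Finset.mul_sum]
        exact Finset.sum_congr rfl fun Q _ => by ring

lemma intertwiner_mul_inv (ω : MulChar F K) (hω : ω ≠ 1) (h : ω (-1) = 1) :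
    intertwiner ω * intertwiner ω⁻¹ = (Fintype.card F : K) • 1 := by
  have hinv : ω⁻¹ ≠ 1 := inv_ne_one.mpr hω
  have h' : ω⁻¹ (-1) = 1 := by rw [MulChar.inv_apply', inv_neg, inv_one, h]
  have e0 : ∀ (χ : MulChar F K), χ ≠ 1 → ∀ y, ∑ x, χ (x - y) = 0 := fun χ hχ y => by
    refine (Fintype.sum_equiv (Equiv.subRight y) _ χ fun x => rfl).trans ?_
    exact MulChar.sum_eq_zero_of_ne_one hχ
  have e0' : ∀ (χ : MulChar F K), χ ≠ 1 → ∀ y, ∑ x, χ (y - x) = 0 := fun χ hχ y => by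
    refine (Fintype.sum_equiv (Equiv.subLeft y) _ χ fun x => rfl).trans ?_
    exact MulChar.sum_eq_zero_of_ne_one hχ
  ext P R
  rw [mul_apply, Matrix.smul_apply, Fintype.sum_option]
  cases P with
  | none =>
    cases R with
    | none => simp [intertwiner, lineRep, h', MulChar.map_zero]
    | some y => simp [intertwiner, lineRep, MulChar.map_zero, e0 _ hinv]
  | some p =>
    cases R with
    | none => simp [intertwiner, lineRep, MulChar.map_zero, h', e0' _ hω]
    | some r =>
      simp only [intertwiner, of_apply, lineRep]
      simp only [cons_val_zero, cons_val_one, mul_zero, one_mul, mul_one, zero_sub, zero_mul,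
        sub_zero, map_one, h]
      rcases eq_or_ne p r with rfl | hpr
      · have : ∀ x, ω (p - x) * ω⁻¹ (x - p) = if x = p then 0 else 1 := fun x => by
          split_ifs with hx
          · simp [hx, MulChar.map_zero]
          · have hx' : x - p ≠ 0 := sub_ne_zero.mpr hx
            rw [← neg_sub, ← neg_one_mul, map_mul, h, one_mul, ← MulChar.mul_apply, mul_inv_cancel,
              MulChar.one_apply hx'.isUnit]
        simp [this, Finset.sum_ite, Finset.filter_ne', Finset.card_erase_of_mem,
          Nat.cast_sub Fintype.card_pos]
      · -- after an affine substitution this is the Jacobi sum `J(ω, ω⁻¹) = -ω (-1)`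
        have hd : p - r ≠ 0 := sub_ne_zero.mpr hpr
        have hsub : ∑ x, ω (p - x) * ω⁻¹ (x - r) = ∑ t, ω t * ω⁻¹ (1 - t) := by
          refine Fintype.sum_equiv ((Equiv.subLeft p).trans (Equiv.divRight₀ (p - r) hd)) _ _
            fun x => ?_
          simp only [Equiv.trans_apply, Equiv.subLeft_apply, Equiv.divRight₀_apply]
          have e1 : p - x = (p - r) * ((p - x) / (p - r)) := by field_simp
          have e2 : x - r = (p - r) * (1 - (p - x) / (p - r)) := by field_simp; ring
          conv_lhs => rw [e1, e2, map_mul, map_mul]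
          have : ω (p - r) * ω⁻¹ (p - r) = 1 := by
            rw [← MulChar.mul_apply, mul_inv_cancel, MulChar.one_apply hd.isUnit]
          linear_combination (ω ((p - x) / (p - r)) * ω⁻¹ (1 - (p - x) / (p - r))) * this
        have hJ : ∑ t, ω t * ω⁻¹ (1 - t) = -ω (-1) := jacobiSum_nontrivial_inv hω
        rw [hsub, hJ, h]
        simp [hpr]

lemma principalSeries_map {K' : Type*} [Field K'] (ω : MulChar F K) (ω' : MulChar F K')
    (hω : ω ^ 3 = 1) (hω' : ω' ^ 3 = 1) {Φ : Type*} [FunLike Φ K K'] [MonoidWithZeroHomClass Φ K K']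
    (θ : Φ) (h : ∀ a, θ (ω a) = ω' a)
    (g : ProjGenLinGroup (Fin 2) F) :
    (principalSeries ω hω g).map θ = principalSeries ω' hω' g := by
  induction g using ProjGenLinGroup.induction_on with | mk g =>
  ext P Q
  rw [principalSeries_mk, principalSeries_mk, map_apply, principalSeriesGL_apply,
    principalSeriesGL_apply, map_mul, MulChar.inv_apply', MulChar.inv_apply', h]
  congr 1
  cases Q <;> simp only [lineCoord] <;> split_ifs <;> simp [h]

end PrincipalSeries

/-! ### Irreducibility -/

section Irreducibility

/-- A matrix representation is irreducible as soon as all its matrix coefficients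
`g ↦ a ⬝ᵥ ρ g *ᵥ v` with `a ≠ 0` and `v ≠ 0` are nonzero functions. Unlike irreducibility itself,
this condition visibly passes from a field to its subfields. -/
lemma isIrreducible_of_forall_exists_dotProduct_ne_zero {G : Type*} [Group G] {ι : Type*}
    [Fintype ι] [DecidableEq ι] [Nonempty ι] {k : Type*} [Field k] (ρ : G →* Matrix ι ι k)
    (h : ∀ v a : ι → k, v ≠ 0 → a ≠ 0 → ∃ g, a ⬝ᵥ ρ g *ᵥ v ≠ 0) :
    (toRepresentation ρ).IsIrreducible where
  exists_pair_ne := by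
    obtain ⟨v, hv⟩ := exists_ne (0 : ι → k)
    refine ⟨⊥, ⊤, fun hbt => hv ?_⟩
    have h1 : v ∈ (⊤ : Subrepresentation (toRepresentation ρ)).toSubmodule := Submodule.mem_top
    rw [← hbt] at h1
    exact (Submodule.mem_bot k).mp h1
  eq_bot_or_eq_top S := by
    by_contra hS
    push Not at hS
    obtain ⟨hbot, htop⟩ := hS
    have hbot' : S.toSubmodule ≠ ⊥ := fun h =>
      hbot (Subrepresentation.toSubmodule_injective h)
    have htop' : S.toSubmodule ≠ ⊤ := fun h =>
      htop (Subrepresentation.toSubmodule_injective h)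
    obtain ⟨v, hvS, hv⟩ := Submodule.exists_mem_ne_zero_of_ne_bot hbot'
    obtain ⟨f, hf, hSf⟩ := Submodule.exists_le_ker_of_lt_top _ (lt_top_iff_ne_top.mpr htop')
    have hfa : ∀ x, (fun i => f (Pi.single i 1)) ⬝ᵥ x = f x := fun x => by
      conv_rhs => rw [pi_eq_sum_univ' x, map_sum]
      refine Finset.sum_congr rfl fun i _ => ?_
      rw [map_smul, smul_eq_mul, mul_comm]
    obtain ⟨g, hg⟩ := h v (fun i => f (Pi.single i 1)) hv fun h0 => hf <| by
      ext1 i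
      ext
      simpa using congrFun h0 i
    rw [hfa] at hg
    exact hg (hSf (S.apply_mem_toSubmodule g hvS))

variable {F : Type*} [Field F] {K : Type*} [Field K]

lemma exists_specialLinearGroup_mulVec_lineRep (P : Option F) :
    ∃ g : SpecialLinearGroup (Fin 2) F, g.1 *ᵥ lineRep none = lineRep P := by
  cases P with
  | none => exact ⟨1, by simp⟩
  | some x =>
    refine ⟨⟨!![x, -1; 1, 0], by simp [det_fin_two]⟩, ?_⟩
    ext i; fin_cases i <;> simp [lineRep]

variable [DecidableEq F] [Fintype F]

lemma principalSeries_inv_mulVec_apply (ω : MulChar F K) (hω : ω ^ 3 = 1)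
    (g : SpecialLinearGroup (Fin 2) F) (x : Option F → K) {P R : Option F} {c : F}
    (h : g.1 *ᵥ lineRep P = c • lineRep R) :
    (principalSeries ω hω (ProjGenLinGroup.mk (SpecialLinearGroup.toGL g⁻¹)) *ᵥ x) P =
      ω c * x R := by
  rw [mulVec, dotProduct]
  have h1 : ((SpecialLinearGroup.toGL g⁻¹)⁻¹ : GL (Fin 2) F).1 = g.1 := by
    rw [map_inv, inv_inv]; rfl
  have h2 : (SpecialLinearGroup.toGL g⁻¹ : GL (Fin 2) F).1.det = 1 := (g⁻¹).2
  simp only [principalSeries_mk, principalSeriesGL_apply, h1, h2, map_one, one_mul, h,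
    lineCoord_smul_lineRep]
  simp

lemma principalSeries_mulVec_single (ω : MulChar F K) (hω : ω ^ 3 = 1)
    (g : SpecialLinearGroup (Fin 2) F) {P R : Option F} {c : F}
    (h : g.1 *ᵥ lineRep P = c • lineRep R) :
    principalSeries ω hω (ProjGenLinGroup.mk (SpecialLinearGroup.toGL g)) *ᵥ Pi.single P 1 =
      (ω c)⁻¹ • Pi.single R 1 := by
  ext Q
  have hdet : (SpecialLinearGroup.toGL g : GL (Fin 2) F).1.det = 1 := g.2
  have hval : (SpecialLinearGroup.toGL g : GL (Fin 2) F).1 = g.1 := rfl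
  rw [mulVec_single_one, col_apply, principalSeries_mk, principalSeriesGL_apply,
    lineCoord_inv_mulVec, hdet, hval, h, lineCoord_smul_lineRep]
  simp [Pi.single_apply, eq_comm, MulChar.inv_apply_eq_inv']

/-- The matrix coefficients of the principal series of a nontrivial character are nonzero already on
`SL₂(F)`. Averaging a vector over the unipotent upper triangular matrices leaves two coordinates,
on which the diagonal matrices act by the distinct characters `ω` and `ω⁻¹`; this isolates the
basis vector of the point at infinity, and `SL₂(F)` is transitive on the points. -/
lemma exists_principalSeries_coeff_ne_zero (ω : MulChar F K) (hω : ω ^ 3 = 1) (hω1 : ω ≠ 1)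
    (hq : (Fintype.card F : K) ≠ 0) {v a : Option F → K} (hv : v ≠ 0) (ha : a ≠ 0) :
    ∃ g : SpecialLinearGroup (Fin 2) F,
      a ⬝ᵥ principalSeries ω hω (ProjGenLinGroup.mk (SpecialLinearGroup.toGL g)) *ᵥ v ≠ 0 := by
  by_contra! hcon
  set M : SpecialLinearGroup (Fin 2) F →* Matrix (Option F) (Option F) K :=
    (principalSeries ω hω).comp (ProjGenLinGroup.mk.comp SpecialLinearGroup.toGL) with hM
  have hMinv : ∀ (g : SpecialLinearGroup (Fin 2) F) (x : Option F → K) {P R : Option F} {c : F},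
      g.1 *ᵥ lineRep P = c • lineRep R → (M g⁻¹ *ᵥ x) P = ω c * x R :=
    fun g x _ _ _ h => principalSeries_inv_mulVec_apply ω hω g x h
  let S : Submodule K (Option F → K) :=
    { carrier := {x | ∀ g, a ⬝ᵥ M g *ᵥ x = 0}
      add_mem' := fun hx hy g => by rw [mulVec_add, dotProduct_add, hx g, hy g, add_zero]
      zero_mem' := fun g => by simp
      smul_mem' := fun c x hx g => by rw [mulVec_smul, dotProduct_smul, hx g, smul_zero] }
  have hSM : ∀ g, ∀ x ∈ S, M g *ᵥ x ∈ S := fun g x hx h => by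
    rw [mulVec_mulVec, ← map_mul]; exact hx _
  have hvS : v ∈ S := hcon
  -- a vector of `S` with nonzero coordinate at infinity
  obtain ⟨P, hP⟩ := Function.ne_iff.mp hv
  obtain ⟨g, hg⟩ := exists_specialLinearGroup_mulVec_lineRep P
  set x := M g⁻¹ *ᵥ v with hx
  have hxS : x ∈ S := hSM _ _ hvS
  have hx0 : x none ≠ 0 := by
    rw [hx, hMinv g v (hg.trans (one_smul F _).symm), map_one, one_mul]; exact hP
  -- average over the unipotent matrices
  let u : F → SpecialLinearGroup (Fin 2) F := fun t => ⟨!![1, t; 0, 1], by simp [det_fin_two]⟩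
  set y := ∑ t, M (u t)⁻¹ *ᵥ x with hy
  have hyS : y ∈ S := S.sum_mem fun t _ => hSM _ _ hxS
  have hy0 : y none = Fintype.card F * x none := by
    have : ∀ t, (M (u t)⁻¹ *ᵥ x) none = x none := fun t => by
      rw [hMinv (u t) x (R := none) (c := 1), map_one, one_mul]
      ext i; fin_cases i <;> simp [u, lineRep]
    simp [hy, Finset.sum_apply, this]
  have hys : ∀ s, y (some s) = ∑ t, x (some t) := fun s => by
    have : ∀ t, (M (u t)⁻¹ *ᵥ x) (some s) = x (some (s + t)) := fun t => by
      rw [hMinv (u t) x (R := some (s + t)) (c := 1), map_one, one_mul]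
      ext i; fin_cases i <;> simp [u, lineRep]
    simp only [hy, Finset.sum_apply, this]
    exact Fintype.sum_equiv (Equiv.addLeft s) _ _ fun t => rfl
  -- separate the two coordinates by a diagonal matrix
  obtain ⟨b, hb⟩ := MulChar.ne_one_iff.mp hω1
  let d : SpecialLinearGroup (Fin 2) F := ⟨!![(b : F), 0; 0, (b : F)⁻¹], by simp [det_fin_two]⟩
  set z := M d⁻¹ *ᵥ y - ω (b : F)⁻¹ • y with hz
  have hzS : z ∈ S := S.sub_mem (hSM _ _ hyS) (S.smul_mem _ hyS)
  have hz0 : z = ((ω b - ω (b : F)⁻¹) * y none) • Pi.single none 1 := by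
    ext R
    cases R with
    | none =>
      have : (M d⁻¹ *ᵥ y) none = ω b * y none := hMinv d y <| by
        ext i; fin_cases i <;> simp [d, lineRep]
      simp [hz, this]; ring
    | some s =>
      have : (M d⁻¹ *ᵥ y) (some s) = ω (b : F)⁻¹ * y (some (b ^ 2 * s)) := hMinv d y <| by
        ext i; fin_cases i <;> simp [d, lineRep]; field_simp
      simp [hz, this, hys]
  have hωb : ω b - ω (b : F)⁻¹ ≠ 0 := fun h => hb <| by
    have h3 := mulChar_pow_three hω b.ne_zero
    have h2 : ω b * ω (b : F)⁻¹ = 1 := by rw [← map_mul, mul_inv_cancel₀ b.ne_zero, map_one]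
    rw [← sub_eq_zero.mp h] at h2
    linear_combination h3 - ω b * h2
  have heS : Pi.single none 1 ∈ S := by
    rw [hz0] at hzS
    exact (S.smul_mem_iff (mul_ne_zero hωb (hy0 ▸ mul_ne_zero hq hx0))).mp hzS
  -- translate the basis vector at infinity to all the others
  refine ha (funext fun Q => ?_)
  obtain ⟨h, hh⟩ := exists_specialLinearGroup_mulVec_lineRep Q
  have := heS h
  have hcol : M h *ᵥ Pi.single none 1 = Pi.single Q 1 := by
    have := principalSeries_mulVec_single ω hω h (hh.trans (one_smul F _).symm)
    rwa [map_one, inv_one, one_smul] at this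
  rwa [hcol, dotProduct_single_one] at this

end Irreducibility

/-! ### Fixed vectors -/

section FixedVectors

variable {F : Type*} [Field F] {K : Type*} [Field K]

lemma mk_eq_one_of_eq_smul_one {g : GL (Fin 2) F} {c : F} (h : g.1 = c • 1) :
    ProjGenLinGroup.mk g = 1 := by
  rw [ProjGenLinGroup.mk_eq_one, GeneralLinearGroup.mem_center_iff_val_mem_range_scalar]
  exact ⟨c, by rw [h]; simp [smul_one_eq_diagonal]⟩

/-- A vector which is not proportional to the representative of the line `P` forms a basis together
with it. -/
lemma eq_smul_lineRep_of_det_eq_zero {P : Option F} {w : Fin 2 → F}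
    (h : lineRep P 0 * w 1 - w 0 * lineRep P 1 = 0) : ∃ c : F, w = c • lineRep P := by
  cases P with
  | none => exact ⟨w 0, by ext i; fin_cases i <;> simp_all [lineRep]⟩
  | some x =>
    simp only [lineRep, cons_val_zero, cons_val_one, mul_one] at h
    exact ⟨w 1, by ext i; fin_cases i <;> simp [lineRep]; linear_combination -h⟩

lemma exists_smul_of_lineCoord_ne_zero [DecidableEq F] {ω : MulChar F K} {v : Fin 2 → F}
    {P : Option F} (h : lineCoord ω v P ≠ 0) : ∃ c : F, v = c • lineRep P := by
  rcases eq_or_ne v 0 with rfl | hv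
  · exact ⟨0, by simp⟩
  · obtain ⟨c, Q, hc, rfl⟩ := exists_smul_lineRep hv
    rw [lineCoord_smul_lineRep] at h
    obtain rfl : Q = P := by by_contra hQ; simp [hQ] at h
    exact ⟨c, rfl⟩

variable [DecidableEq F] [Fintype F]

lemma principalSeries_apply_self_of_mem_zpowers (ω : MulChar F K) (hω : ω ^ 3 = 1)
    {g : GL (Fin 2) F} {P : Option F} (hP : ∀ c : F, g.1 *ᵥ lineRep P ≠ c • lineRep P)
    {h : ProjGenLinGroup (Fin 2) F} (hh : h ∈ Subgroup.zpowers (ProjGenLinGroup.mk g))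
    (h1 : h ≠ 1) : principalSeries ω hω h P P = 0 := by
  obtain ⟨n, rfl⟩ := Subgroup.mem_zpowers_iff.mp hh
  by_contra hne
  rw [← map_zpow, principalSeries_mk, principalSeriesGL_apply] at hne
  obtain ⟨c, hc⟩ := exists_smul_of_lineCoord_ne_zero (right_ne_zero_of_mul hne)
  have hcomm : g.1 * ((g ^ n)⁻¹ : GL (Fin 2) F).1 = ((g ^ n)⁻¹ : GL (Fin 2) F).1 * g.1 := by
    rw [← Units.val_mul, ← Units.val_mul, (((Commute.refl g).zpow_right n).inv_right).eq]
  set B := ((g ^ n)⁻¹ : GL (Fin 2) F).1 with hB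
  have hc' : B *ᵥ (g.1 *ᵥ lineRep P) = c • (g.1 *ᵥ lineRep P) := by
    rw [mulVec_mulVec, ← hcomm, ← mulVec_mulVec, hc, mulVec_smul]
  -- `B` and `c` agree on the basis formed by the line and its image under `g`
  let N : Matrix (Fin 2) (Fin 2) F := (of ![lineRep P, g.1 *ᵥ lineRep P])ᵀ
  have hN : IsUnit N.det := by
    rw [isUnit_iff_ne_zero]
    intro h0
    obtain ⟨d, hd⟩ := eq_smul_lineRep_of_det_eq_zero (P := P) (w := g.1 *ᵥ lineRep P) <| by
      rw [← h0, det_fin_two]; simp [N]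
    exact hP d hd
  have hBN : B * N = (c • 1) * N := by
    ext i j
    rw [smul_mul_assoc, one_mul]
    fin_cases j
    · exact congrFun hc i
    · exact congrFun hc' i
  have hBc : B = c • 1 := by
    have := congrArg (· * N⁻¹) hBN
    simpa only [mul_assoc, mul_nonsing_inv N hN, mul_one] using this
  have := mk_eq_one_of_eq_smul_one hBc
  rw [map_inv, map_zpow, inv_eq_one] at this
  exact h1 this

/-- Every element of `PGL₂(F)` has a nonzero fixed vector in the principal series: a nonscalar `g`
generates a group which acts freely on the orbit of any line that is not an eigenline of `g`, since
an eigenvector `v` of `g ^ n` which is not one of `g` yields the second eigenvector `g v` with the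
same eigenvalue. The sum over the group of the translates of the basis vector of such a line is
fixed. -/
lemma det_principalSeries_sub_one (ω : MulChar F K) (hω : ω ^ 3 = 1)
    (g : ProjGenLinGroup (Fin 2) F) : (principalSeries ω hω g - 1).det = 0 := by
  classical
  induction g using ProjGenLinGroup.induction_on with | mk g =>
  by_cases hsc : ∀ P : Option F, ∃ c : F, g.1 *ᵥ lineRep P = c • lineRep P
  · obtain ⟨a, ha⟩ := hsc none
    obtain ⟨b, hb⟩ := hsc (some 0)
    obtain ⟨c, hc⟩ := hsc (some 1)
    have hg : g.1 = c • 1 := by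
      have a0 := congrFun ha 0
      have a1 := congrFun ha 1
      have b0 := congrFun hb 0
      have b1 := congrFun hb 1
      have c0 := congrFun hc 0
      have c1 := congrFun hc 1
      simp [lineRep, mulVec, dotProduct, Fin.sum_univ_two] at a0 a1 b0 b1 c0 c1
      ext i j
      fin_cases i <;> fin_cases j <;> simp_all
    rw [mk_eq_one_of_eq_smul_one hg, map_one, sub_self, det_zero]
  · push Not at hsc
    obtain ⟨P, hP⟩ := hsc
    have : Finite (ProjGenLinGroup (Fin 2) F) :=
      Finite.of_surjective _ ProjGenLinGroup.mk_surjective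
    let H := Subgroup.zpowers (ProjGenLinGroup.mk g)
    have : Fintype H := Fintype.ofFinite H
    let x : Option F → K := ∑ h : H, principalSeries ω hω h *ᵥ Pi.single P 1
    have hxP : x P = 1 := by
      simp only [x, Finset.sum_apply, mulVec_single_one, col_apply]
      rw [Finset.sum_eq_single 1 (fun h _ h1 => principalSeries_apply_self_of_mem_zpowers ω hω hP
        h.2 fun h0 => h1 (Subtype.ext h0)) (fun h => absurd (Finset.mem_univ _) h)]
      simp
    have hfix : principalSeries ω hω (ProjGenLinGroup.mk g) *ᵥ x = x := by
      simp only [x, mulVec_sum, mulVec_mulVec, ← map_mul]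
      exact Fintype.sum_equiv
        (Equiv.mulLeft (⟨_, Subgroup.mem_zpowers (ProjGenLinGroup.mk g)⟩ : H)) _ _ fun h => rfl
    refine exists_mulVec_eq_zero_iff.mp ⟨x, fun h0 => ?_, by
      rw [sub_mulVec, hfix, one_mulVec, sub_self]⟩
    rw [h0] at hxP
    exact zero_ne_one hxP

end FixedVectors

/-! ### Symplectic bases -/

section Symplectic

/-- A nondegenerate alternating form on a space of dimension `2 * n` has the standard Gram matrix
with respect to some family of vectors. -/
lemma exists_gram_eq_J {k : Type*} [Field k] (n : ℕ) {V : Type*} [AddCommGroup V] [Module k V]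
    [FiniteDimensional k V] (B : V →ₗ[k] V →ₗ[k] k) (halt : ∀ v, B v v = 0)
    (hnd : ∀ v, (∀ w, B v w = 0) → v = 0) (hV : Module.finrank k V = 2 * n) :
    ∃ b : Fin n ⊕ Fin n → V, ∀ i j, B (b i) (b j) = J (Fin n) k i j := by
  induction n generalizing V with
  | zero => exact ⟨fun i => i.elim Fin.elim0 Fin.elim0, by rintro (i | i) <;> exact i.elim0⟩
  | succ n ih =>
    have hskew : ∀ v w, B w v = -B v w := fun v w => by
      have := halt (v + w)
      simp only [map_add, LinearMap.add_apply, halt] at this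
      linear_combination this
    have : Nontrivial V := Module.nontrivial_of_finrank_pos (R := k) (by omega)
    obtain ⟨u, hu⟩ := exists_ne (0 : V)
    obtain ⟨v, huv⟩ : ∃ v, B u v = -1 := by
      by_contra! hcon
      refine hu (hnd u fun w => ?_)
      by_contra hw
      exact hcon (-(B u w)⁻¹ • w) (by simp [hw])
    have hvu : B v u = 1 := by rw [hskew u v, huv, neg_neg]
    let L : V →ₗ[k] k × k := (B u).prod (B v)
    have hL : Function.Surjective L := fun p => ⟨p.2 • u - p.1 • v, by
      ext <;> simp [L, halt, huv, hvu]⟩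
    have hfin : Module.finrank k L.ker = 2 * n := by
      have := L.finrank_range_add_finrank_ker
      rw [LinearMap.range_eq_top.mpr hL, finrank_top, Module.finrank_prod, Module.finrank_self,
        hV] at this
      omega
    have hmem : ∀ w : L.ker, B u w = 0 ∧ B v w = 0 := fun w => by
      simpa [L, Prod.ext_iff] using w.2
    have hmem' : ∀ w : L.ker, B w u = 0 ∧ B w v = 0 := fun w => by
      rw [hskew u, hskew v, (hmem w).1, (hmem w).2, neg_zero, and_self]
    obtain ⟨b, hb⟩ := ih (B.domRestrict₁₂ L.ker L.ker) (fun w => halt w) (fun w hw => by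
      refine Subtype.ext (hnd w fun x => ?_)
      -- the projection of `x` to the orthogonal complement of `u` and `v`
      have hx : x - B v x • u + B u x • v ∈ L.ker := by
        simp [L, halt, huv, hvu]
      have := hw ⟨_, hx⟩
      simpa [LinearMap.domRestrict₁₂_apply, (hmem' w).1, (hmem' w).2] using this) hfin
    have hb' : ∀ i j, B (b i) (b j) = J (Fin n) k i j := hb
    refine ⟨Sum.elim (Fin.cons u fun i => b (.inl i)) (Fin.cons v fun i => b (.inr i)), ?_⟩
    rintro (i | i) (j | j) <;> refine Fin.cases ?_ (fun i => ?_) i <;>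
      refine Fin.cases ?_ (fun j => ?_) j <;>
      simp [J, halt, huv, hvu, hmem, hmem', hb', Matrix.one_apply, Fin.succ_ne_zero,
        (Fin.succ_ne_zero _).symm]

end Symplectic

/-! ### Descent from the field with four elements -/

section Descent

variable {k : Type*} [Field k] {X : Type*} [Fintype X]

lemma dotProduct_mulVec_self_eq_zero [CharP k 2] {S : Matrix X X k} (hS : Sᵀ = S)
    (h0 : ∀ i, S i i = 0)
    (f : X → k) : f ⬝ᵥ S *ᵥ f = 0 := by
  have : f ⬝ᵥ S *ᵥ f = ∑ p : X × X, f p.1 * (S p.1 p.2 * f p.2) := by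
    rw [Fintype.sum_prod_type]
    simp [dotProduct, mulVec, Finset.mul_sum]
  rw [this]
  refine Finset.sum_involution (fun p _ => p.swap) (fun p _ => ?_) (fun p _ hp hs => hp ?_)
    (fun _ _ => Finset.mem_univ _) (fun _ _ => Prod.swap_swap _)
  · have hSp : S p.2 p.1 = S p.1 p.2 := congrFun (congrFun hS p.1) p.2
    rw [Prod.fst_swap, Prod.snd_swap, hSp]
    linear_combination CharTwo.add_self_eq_zero (f p.1 * (S p.1 p.2 * f p.2))
  · have : p.1 = p.2 := congrArg Prod.snd hs
    rw [this, h0, zero_mul, mul_zero]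

variable [Algebra (ZMod 2) k]

lemma eq_algebraMap_of_sq_eq_self {c : k} (h : c ^ 2 = c) (l : k →ₗ[ZMod 2] ZMod 2)
    (hl : ∀ a, l (algebraMap (ZMod 2) k a) = a) : algebraMap (ZMod 2) k (l c) = c := by
  have : c = 0 ∨ c = 1 := by
    have : c * (c - 1) = 0 := by linear_combination h
    rcases mul_eq_zero.mp this with h | h
    · exact .inl h
    · exact .inr (sub_eq_zero.mp h)
  rcases this with rfl | rfl
  · simp
  · rw [← map_one (algebraMap (ZMod 2) k), hl]

lemma exists_retraction_algebraMap :
    ∃ l : k →ₗ[ZMod 2] ZMod 2, ∀ a, l (algebraMap (ZMod 2) k a) = a := by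
  obtain ⟨l, hl⟩ := LinearMap.exists_leftInverse_of_injective (Algebra.linearMap (ZMod 2) k)
    (LinearMap.ker_eq_bot.mpr (algebraMap (ZMod 2) k).injective)
  exact ⟨l, fun a => LinearMap.congr_fun hl a⟩

variable [Finite k] (hk : Module.finrank (ZMod 2) k = 2)

include hk in
lemma pow_four_eq_self (c : k) : (c ^ 2) ^ 2 = c := by
  have := Fintype.ofFinite k
  have hcard : Fintype.card k = 4 := by
    rw [Module.card_eq_pow_finrank (K := ZMod 2), hk, ZMod.card]; norm_num
  rw [← pow_mul]
  simpa only [hcard] using FiniteField.pow_card c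

variable [CharP k 2]

include hk in
lemma exists_sq_eq_add_one : ∃ z : k, z ^ 2 = z + 1 := by
  obtain ⟨z, hz⟩ : ∃ z : k, z ^ 2 ≠ z := by
    by_contra! hcon
    obtain ⟨l, hl⟩ := exists_retraction_algebraMap (k := k)
    have hinj : Function.Injective l := fun a b hab => by
      rw [← eq_algebraMap_of_sq_eq_self (hcon a) l hl, hab,
        eq_algebraMap_of_sq_eq_self (hcon b) l hl]
    have := LinearMap.finrank_le_finrank_of_injective hinj
    rw [hk, Module.finrank_self] at this
    omega
  refine ⟨z, ?_⟩
  have h4 := pow_four_eq_self hk z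
  have h2 : (2 : k) = 0 := CharTwo.two_eq_zero
  have : (z ^ 2 - z) * (z ^ 2 - (z + 1)) = 0 := by
    linear_combination h4 + (z - z ^ 3) * h2
  rcases mul_eq_zero.mp this with h | h
  · exact absurd (sub_eq_zero.mp h) hz
  · exact sub_eq_zero.mp h

variable [DecidableEq X] {T : Matrix X X k} (hT : Tᵀ = T) (hT0 : ∀ i, T i i = 0)
  (hTT : T * T.map (frobenius k 2) = 1) {n : ℕ} (hn : Fintype.card X = 2 * n)

include hk hT hT0 hTT hn in
/-- Over the field with four elements, a symmetric matrix `T` with zero diagonal which is inverse to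
its conjugate defines the conjugate-linear involution `f ↦ T f̄`, whose fixed vectors are an
`𝔽₂`-form of the space on which the form of the conjugate of `T` is `𝔽₂`-valued, alternating and
nondegenerate. The columns of `P` are a symplectic basis of this `𝔽₂`-form. -/
lemma exists_symplectic_basis_of_conj :
    ∃ P : Matrix X (Fin n ⊕ Fin n) k, Pᵀ * T.map (frobenius k 2) * P = J (Fin n) k ∧
      P.map (frobenius k 2) = T.map (frobenius k 2) * P := by
  set σ := frobenius k 2 with hσ
  have hσσ : ∀ c, σ (σ c) = c := fun c => pow_four_eq_self hk c
  obtain ⟨z, hz⟩ := exists_sq_eq_add_one hk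
  obtain ⟨l, hl⟩ := exists_retraction_algebraMap (k := k)
  have h2 : ∀ v : X → k, v + v = 0 := fun v => funext fun i => CharTwo.add_self_eq_zero (v i)
  have hTT' : T.map σ * T = 1 := mul_eq_one_comm.mp hTT
  have hS : (T.map σ)ᵀ = T.map σ := by rw [← transpose_map, hT]
  have hmv : ∀ (A : Matrix X X k) (v : X → k), σ ∘ (A *ᵥ v) = A.map σ *ᵥ (σ ∘ v) :=
    fun A v => funext fun i => RingHom.map_mulVec σ A v i
  -- `D v = v + T v̄`; the image and the kernel of `D` are both the space of fixed vectors
  let D : (X → k) →ₗ[ZMod 2] (X → k) := AddMonoidHom.toZModLinearMap 2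
    { toFun := fun v => v + T *ᵥ (σ ∘ v)
      map_zero' := by
        have : σ ∘ (0 : X → k) = 0 := funext fun i => map_zero σ
        simp [this]
      map_add' := fun v w => by
        have : σ ∘ (v + w) = σ ∘ v + σ ∘ w := funext fun i => map_add σ _ _
        rw [this, mulVec_add]; abel }
  have hD : ∀ v, D v = v + T *ᵥ (σ ∘ v) := fun v => rfl
  have hker : ∀ v, v ∈ D.ker ↔ T.map σ *ᵥ v = σ ∘ v := fun v => by
    rw [LinearMap.mem_ker, hD]
    constructor
    · intro h
      have : v = T *ᵥ (σ ∘ v) := by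
        rw [← sub_eq_zero, ← h, sub_eq_add_neg, neg_eq_of_add_eq_zero_left (h2 _)]
      conv_lhs => rw [this, mulVec_mulVec, hTT', one_mulVec]
    · intro h
      rw [← h, mulVec_mulVec, hTT, one_mulVec, h2]
  have hrange : D.range = D.ker := by
    refine le_antisymm ?_ fun v hv => ?_
    · rintro _ ⟨v, rfl⟩
      have h1 : σ ∘ (σ ∘ v) = v := funext fun i => hσσ _
      rw [LinearMap.mem_ker, hD (D v), hD v]
      have h3 : σ ∘ (v + T *ᵥ (σ ∘ v)) = σ ∘ v + T.map σ *ᵥ v := by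
        conv_rhs => rw [← h1, ← hmv, h1]
        exact funext fun i => map_add σ _ _
      rw [h3, mulVec_add, mulVec_mulVec, hTT, one_mulVec, add_comm v (T *ᵥ _), h2]
    · refine ⟨z • v, ?_⟩
      have hv' := (hker v).mp hv
      have h3 : σ ∘ (z • v) = (z + 1) • (σ ∘ v) := funext fun i => by
        simp [hσ, frobenius_def, mul_pow, hz]
      rw [hD, h3, ← hv', mulVec_smul, mulVec_mulVec, hTT, one_mulVec, add_smul, one_smul,
        ← add_assoc, h2, zero_add]
  have hfin : Module.finrank (ZMod 2) D.ker = 2 * n := by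
    have h := D.finrank_range_add_finrank_ker
    rw [hrange, Module.finrank_pi_fintype] at h
    simp only [hk, Finset.sum_const, Finset.card_univ, hn, smul_eq_mul] at h
    omega
  -- the form is `𝔽₂`-valued on the fixed vectors
  have hval : ∀ v w : D.ker, algebraMap (ZMod 2) k (l (v.1 ⬝ᵥ T.map σ *ᵥ w.1)) =
      v.1 ⬝ᵥ T.map σ *ᵥ w.1 := fun v w => by
    refine eq_algebraMap_of_sq_eq_self ?_ l hl
    change σ _ = _
    rw [(hker w).mp w.2, RingHom.map_dotProduct]
    have h1 : σ ∘ (σ ∘ w.1) = w.1 := funext fun i => hσσ _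
    rw [h1, ← (hker v).mp v.2, ← (hker w).mp w.2, dotProduct_mulVec, ← mulVec_transpose, hS]
  let B : D.ker →ₗ[ZMod 2] D.ker →ₗ[ZMod 2] ZMod 2 := LinearMap.mk₂ (ZMod 2)
    (fun v w => l (v.1 ⬝ᵥ T.map σ *ᵥ w.1))
    (fun v v' w => by rw [Submodule.coe_add, add_dotProduct, map_add])
    (fun c v w => by rw [Submodule.coe_smul, smul_dotProduct, map_smul])
    (fun v w w' => by rw [Submodule.coe_add, mulVec_add, dotProduct_add, map_add])
    (fun c v w => by rw [Submodule.coe_smul, mulVec_smul, dotProduct_smul, map_smul])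
  have hB : ∀ v w, algebraMap (ZMod 2) k (B v w) = v.1 ⬝ᵥ T.map σ *ᵥ w.1 := hval
  obtain ⟨b, hb⟩ := exists_gram_eq_J n B
    (fun v => (algebraMap (ZMod 2) k).injective <| by
      rw [hB, map_zero]
      exact dotProduct_mulVec_self_eq_zero hS (fun i => by simp [hT0]) _)
    (fun v hv => by
      have hv' : ∀ w : X → k, v.1 ⬝ᵥ T.map σ *ᵥ D w = 0 := fun w => by
        rw [← hB v ⟨D w, hrange ▸ ⟨w, rfl⟩⟩, hv, map_zero]
      -- test against the vectors `D (c • eᵢ)` for `c = 1` and `c = z`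
      have hv2 : ∀ i (c : k), σ (v.1 i) * c + v.1 i * σ c = 0 := fun i c => by
        have := hv' (Pi.single i c)
        have h3 : σ ∘ (Pi.single i c : X → k) = Pi.single i (σ c) := funext fun j => by
          by_cases h : j = i
          · subst h; simp
          · simp [h]
        rw [hD, mulVec_add, mulVec_mulVec, hTT', one_mulVec, dotProduct_add, h3,
          dotProduct_single, dotProduct_mulVec, ← mulVec_transpose, hS, (hker v).mp v.2,
          dotProduct_single] at this
        exact this
      refine Subtype.ext (funext fun i => ?_)
      have e1 := hv2 i 1
      have e2 := hv2 i z
      have hσz : σ z = z + 1 := hz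
      rw [hσz] at e2
      rw [map_one] at e1
      change v.1 i = 0
      linear_combination e2 - z * e1) hfin
  refine ⟨of fun x j => (b j).1 x, ?_, ?_⟩
  · ext i j
    have := hB (b i) (b j)
    rw [hb] at this
    rw [Matrix.mul_assoc, mul_apply]
    have hJ : algebraMap (ZMod 2) k (J (Fin n) (ZMod 2) i j) = J (Fin n) k i j := by
      rw [← map_J _ (algebraMap (ZMod 2) k), map_apply]
    rw [← hJ, this]
    rfl
  · ext x j
    exact (congrFun ((hker _).mp (b j).2) x).symm

include hk hT hT0 hTT hn in
/-- Descent to a symplectic representation over `𝔽₂` of a representation over the field with four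
elements which preserves the conjugate-linear involution and the form given by `T`. -/
lemma exists_symplectic_descent {G : Type*} [Group G] (M : G →* Matrix X X k)
    (hMT : ∀ g, M g * T = T * (M g).map (frobenius k 2))
    (hform : ∀ g, (M g)ᵀ * T.map (frobenius k 2) * M g = T.map (frobenius k 2)) :
    ∃ (φ : G →* symplecticGroup (Fin n) (ZMod 2)) (P : Matrix X (Fin n ⊕ Fin n) k)
      (P' : Matrix (Fin n ⊕ Fin n) X k), P * P' = 1 ∧ P' * P = 1 ∧
      ∀ g, (φ g).1.map (algebraMap (ZMod 2) k) = P' * M g * P := by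
  obtain ⟨P, hPJ, hPσ⟩ := exists_symplectic_basis_of_conj hk hT hT0 hTT hn
  obtain ⟨l, hl⟩ := exists_retraction_algebraMap (k := k)
  set σ := frobenius k 2 with hσ
  have hσσ : ∀ A : Matrix X X k, (A.map σ).map σ = A := fun A => by
    ext i j; exact pow_four_eq_self hk (A i j)
  have hP'P : (-(J (Fin n) k * (Pᵀ * T.map σ))) * P = 1 := by
    rw [Matrix.neg_mul, Matrix.mul_assoc, hPJ, J_squared, neg_neg]
  set P' := -(J (Fin n) k * (Pᵀ * T.map σ))
  have hcard : Fintype.card X = Fintype.card (Fin n ⊕ Fin n) := by simp [hn, two_mul]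
  have hPP' : P * P' = 1 := (mul_eq_one_comm_of_card_eq _ _ _ hcard.symm).mp hP'P
  have hconj : ∀ g, (P' * M g * P).map σ = P' * M g * P := fun g => by
    have hbar : (M g).map σ * T.map σ = T.map σ * M g := by
      have := congrArg (fun A => A.map σ) (hMT g)
      simpa only [Matrix.map_mul, hσσ] using this
    have h1 : P'.map σ * P.map σ = 1 := by
      rw [← Matrix.map_mul, hP'P, Matrix.map_one _ (map_zero σ) (map_one σ)]
    calc (P' * M g * P).map σ = P'.map σ * ((M g).map σ * T.map σ) * P := by
          rw [Matrix.map_mul, Matrix.map_mul, hPσ]; simp only [Matrix.mul_assoc]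
      _ = P'.map σ * (T.map σ * (P * P') * M g) * P := by rw [hbar, hPP', Matrix.mul_one]
      _ = (P'.map σ * (T.map σ * P)) * (P' * M g * P) := by simp only [Matrix.mul_assoc]
      _ = _ := by rw [← hPσ, h1, Matrix.one_mul]
  have hmap : ∀ g, ((P' * M g * P).map l).map (algebraMap (ZMod 2) k) = P' * M g * P := fun g => by
    ext i j
    exact eq_algebraMap_of_sq_eq_self (congrFun (congrFun (hconj g) i) j) l hl
  have hinj : Function.Injective (fun A : Matrix (Fin n ⊕ Fin n) (Fin n ⊕ Fin n) (ZMod 2) =>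
      A.map (algebraMap (ZMod 2) k)) := Matrix.map_injective (algebraMap (ZMod 2) k).injective
  let ψ : G →* Matrix (Fin n ⊕ Fin n) (Fin n ⊕ Fin n) (ZMod 2) :=
    { toFun := fun g => (P' * M g * P).map l
      map_one' := hinj <| (hmap 1).trans <| by
        rw [map_one, Matrix.mul_one, hP'P]
        exact (Matrix.map_one _ (map_zero _) (map_one _)).symm
      map_mul' := fun g h => hinj <| (hmap (g * h)).trans <| by
        simp only [Matrix.map_mul, hmap, map_mul]
        calc P' * (M g * M h) * P = P' * M g * (1 : Matrix X X k) * M h * P := by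
              simp only [Matrix.mul_assoc, Matrix.one_mul]
          _ = _ := by rw [← hPP']; simp only [Matrix.mul_assoc] }
  have hψ : ∀ g, (ψ g).map (algebraMap (ZMod 2) k) = P' * M g * P := hmap
  have hmem : ∀ g, ψ g ∈ symplecticGroup (Fin n) (ZMod 2) := fun g => by
    rw [← SymplecticGroup.transpose_mem_iff, SymplecticGroup.mem_iff, transpose_transpose]
    apply hinj
    simp only [Matrix.map_mul, transpose_map, hψ, map_J]
    calc (P' * M g * P)ᵀ * J (Fin n) k * (P' * M g * P)
        = Pᵀ * (M g)ᵀ * (P * P')ᵀ * T.map σ * (P * P') * M g * P := by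
          rw [transpose_mul, transpose_mul, transpose_mul]
          simp only [Matrix.mul_assoc]
          rw [← hPJ]
          simp only [Matrix.mul_assoc]
      _ = Pᵀ * ((M g)ᵀ * T.map σ * M g) * P := by
          rw [hPP']; simp only [transpose_one, Matrix.one_mul, Matrix.mul_assoc]
      _ = _ := by rw [hform, hPJ]
  exact ⟨ψ.codRestrict _ hmem, P, P', hPP', hP'P, hψ⟩

end Descent

/-! ### Brauer characters of matrices with root of unity entries -/

section BrauerLift

open Polynomial in
/-- Let `A` be a matrix whose entries are `0` or `m`-th roots of unity, such that the entrywise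
image of `A` under `θ` is of order dividing `m`. Then the sum of the lifts of the eigenvalues of `A`
is the trace of the lifted matrix. Indeed both matrices are images of one matrix over `ℤ[X] / Φₘ`,
which embeds in `ℂ` as the ring generated by the `m`-th roots of unity; the factorization of the
characteristic polynomial into linear factors takes place over this ring and can be
specialized. -/
lemma sum_map_roots_charpoly_eq_trace {Ω : Type*} [Field Ω] {ι : Type*} [Fintype ι]
    [DecidableEq ι] (θ : Ω →*₀ ℂ) (hθ : Function.Injective θ) {m : ℕ} [NeZero m] {z : Ω}
    (hz : IsPrimitiveRoot z m) (A : Matrix ι ι Ω) (hA : ∀ i j, A i j = 0 ∨ A i j ^ m = 1)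
    (hAm : A.map θ ^ m = 1) :
    (A.charpoly.roots.map θ).sum = (A.map θ).trace := by
  have hm : 0 < m := NeZero.pos m
  have hθz : IsPrimitiveRoot (θ z) m := hz.map_of_injective hθ
  let R := AdjoinRoot (cyclotomic m ℤ)
  let r : R := AdjoinRoot.root _
  have hevℂ : (cyclotomic m ℤ).eval₂ (Int.castRingHom ℂ) (θ z) = 0 := by
    rw [eval₂_eq_eval_map, map_cyclotomic_int]
    exact hθz.isRoot_cyclotomic hm
  have hevΩ : (cyclotomic m ℤ).eval₂ (Int.castRingHom Ω) z = 0 := by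
    rw [eval₂_eq_eval_map, map_cyclotomic_int]
    exact hz.isRoot_cyclotomic hm
  let α : R →+* ℂ := AdjoinRoot.lift (Int.castRingHom ℂ) (θ z) hevℂ
  let β : R →+* Ω := AdjoinRoot.lift (Int.castRingHom Ω) z hevΩ
  have hαr : α r = θ z := AdjoinRoot.lift_root _
  have hβr : β r = z := AdjoinRoot.lift_root _
  have hα : Function.Injective α := by
    rw [injective_iff_map_eq_zero]
    intro x hx
    induction x using AdjoinRoot.induction_on with | ih p =>
    rw [AdjoinRoot.mk_eq_zero, cyclotomic_eq_minpoly hθz hm]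
    refine minpoly.isIntegrallyClosed_dvd (hθz.isIntegral hm) ?_
    rwa [AdjoinRoot.lift_mk] at hx
  -- lift the entries of `A`
  have hN : ∀ i j, ∃ x : R, α x = θ (A i j) ∧ β x = A i j := fun i j => by
    rcases hA i j with h | h
    · exact ⟨0, by simp [h], by simp [h]⟩
    · obtain ⟨l, -, hl⟩ := hz.eq_pow_of_pow_eq_one h
      exact ⟨r ^ l, by rw [map_pow, hαr, ← hl, map_pow], by rw [map_pow, hβr, hl]⟩
  choose N hNα hNβ using hN
  have hNα' : (of N).map α = A.map θ := by ext i j; exact hNα i j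
  have hNβ' : (of N).map β = A := by ext i j; exact hNβ i j
  -- lift the eigenvalues of the complex matrix
  have hroot : ∀ x ∈ (A.map θ).charpoly.roots, ∃ l : ℕ, θ z ^ l = x := fun x hx => by
    have h1 : x ∈ spectrum ℂ (A.map θ) :=
      mem_spectrum_iff_isRoot_charpoly.mpr (isRoot_of_mem_roots hx)
    have h2 := spectrum.pow_mem_pow (A.map θ) m h1
    have : Nonempty ι := by
      by_contra h
      rw [not_nonempty_iff] at h
      rw [charpoly, det_isEmpty, roots_one] at hx
      exact absurd hx (Multiset.notMem_zero x)
    rw [hAm, spectrum.one_eq, Set.mem_singleton_iff] at h2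
    obtain ⟨l, -, hl⟩ := hθz.eq_pow_of_pow_eq_one h2
    exact ⟨l, hl⟩
  have hex : ∃ l : ℂ → ℕ, ∀ x ∈ (A.map θ).charpoly.roots, θ z ^ l x = x := by
    classical
    exact ⟨fun x => if hx : x ∈ (A.map θ).charpoly.roots then (hroot x hx).choose else 0,
      fun x hx => by simp only [dif_pos hx]; exact (hroot x hx).choose_spec⟩
  obtain ⟨l, hl⟩ := hex
  obtain ⟨t, ht, htθ⟩ : ∃ t : Multiset R, t.map α = (A.map θ).charpoly.roots ∧
      t.map (fun x => θ (β x)) = t.map α := by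
    refine ⟨(A.map θ).charpoly.roots.map fun x => r ^ l x, ?_, ?_⟩
    · rw [Multiset.map_map]
      conv_rhs => rw [← Multiset.map_id (A.map θ).charpoly.roots]
      refine Multiset.map_congr rfl fun x hx => ?_
      simp only [Function.comp_apply, map_pow, hαr, hl x hx, id]
    · rw [Multiset.map_map, Multiset.map_map]
      refine Multiset.map_congr rfl fun x _ => ?_
      simp only [Function.comp_apply, map_pow, hαr, hβr]
  have hchar : (of N).charpoly = (t.map fun a => X - C a).prod := by
    apply Polynomial.map_injective α hα
    rw [← charpoly_map, hNα', Polynomial.map_multiset_prod, Multiset.map_map,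
      (IsAlgClosed.splits (A.map θ).charpoly).eq_prod_roots_of_monic (charpoly_monic _)]
    conv_lhs => rw [← ht, Multiset.map_map]
    simp
  have hcharA : A.charpoly.roots = t.map β := by
    rw [← hNβ', charpoly_map, hchar, Polynomial.map_multiset_prod, Multiset.map_map,
      ← roots_multiset_prod_X_sub_C (t.map β), Multiset.map_map]
    simp
  rw [trace_eq_sum_roots_charpoly, hcharA, ← ht, ← htθ, Multiset.map_map]
  rfl

lemma charpoly_conj_of_mul_eq_one {Ω : Type*} [Field Ω] {X Y : Type*} [Fintype X] [Fintype Y]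
    [DecidableEq X] [DecidableEq Y] {P : Matrix X Y Ω} {P' : Matrix Y X Ω} (h : P * P' = 1)
    (hcard : Fintype.card X = Fintype.card Y) (A : Matrix X X Ω) :
    (P' * A * P).charpoly = A.charpoly := by
  have := charpoly_mul_comm' P' (A * P)
  rw [Matrix.mul_assoc A, h, Matrix.mul_one, hcard] at this
  rw [Matrix.mul_assoc]
  exact (Polynomial.isRegular_X_pow _).left this

end BrauerLift

/-! ### Induced characters of monomial representations -/

section InducedCharacter

variable {G : Type*} [Group G] {X : Type*} [Fintype X] [DecidableEq X]
  (M : G →* Matrix X X ℂ) (o : X) (B : Subgroup G)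

/-- A transitive monomial representation `M` is induced from the stabilizer `B` of a line, and this
is its combinatorial content: each group element `x` moves the base line to that of a point `π x`,
the fibres of `π` being cosets of `B`, and the diagonal entries of conjugates of `g` at the base
point are the diagonal entries of `g`. -/
lemma exists_fiber_map_of_monomial
    (hmono : ∀ x, ∃ P : X, ∃ c : ℂ, c ≠ 0 ∧ (∀ y, (M x⁻¹ *ᵥ y) o = c * y P) ∧
      M x *ᵥ Pi.single o 1 = c⁻¹ • Pi.single P 1)
    (htrans : ∀ P, ∃ x, M x *ᵥ Pi.single o 1 = Pi.single P 1)
    (hB : ∀ x, x ∈ B ↔ M x o o ≠ 0) :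
    ∃ π : G → X, (∀ x g, M (x⁻¹ * g * x) o o = M g (π x) (π x)) ∧
      ∀ P, Nat.card {x // π x = P} = Nat.card B := by
  choose π c hc hrow hcol using hmono
  have hentry : ∀ x P, M x P o = (M x *ᵥ Pi.single o 1) P := fun x P => by
    rw [mulVec_single_one, col_apply]
  refine ⟨π, fun x g => ?_, fun P => ?_⟩
  · rw [hentry, map_mul, map_mul, mul_assoc, ← mulVec_mulVec, hrow, ← mulVec_mulVec, hcol,
      mulVec_smul, mulVec_single_one, Pi.smul_apply, smul_eq_mul, col_apply,
      mul_inv_cancel_left₀ (hc x)]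
  · obtain ⟨h, hh⟩ := htrans P
    have hh' : M h⁻¹ *ᵥ Pi.single P 1 = Pi.single o 1 := by
      rw [← hh, mulVec_mulVec, ← map_mul, inv_mul_cancel, map_one, one_mulVec]
    have key : ∀ x, π x = P ↔ h⁻¹ * x ∈ B := fun x => by
      have e : M (h⁻¹ * x) *ᵥ Pi.single o 1 = (c x)⁻¹ • (M h⁻¹ *ᵥ Pi.single (π x) 1) := by
        rw [map_mul, ← mulVec_mulVec, hcol, mulVec_smul]
      constructor
      · intro hx
        rw [hB, hentry, e, hx, hh']
        simpa using hc x
      · intro hx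
        -- an element of `B` maps the base vector to a multiple of itself
        rw [hB, hentry, hcol] at hx
        have hπ : π (h⁻¹ * x) = o := by
          by_contra hne
          exact hx (by simp [Ne.symm hne])
        have e2 := hcol (h⁻¹ * x)
        rw [hπ, e] at e2
        have e3 := congrArg (fun y => M h *ᵥ y) e2
        simp only [mulVec_smul, mulVec_mulVec, ← map_mul, mul_inv_cancel, map_one, one_mulVec,
          hh] at e3
        by_contra hne
        have := congrFun e3 (π x)
        simp [hne, hc x] at this
    exact Nat.card_congr
      ((Equiv.mulLeft h⁻¹).subtypeEquiv fun x => key x)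

variable (hmono : ∀ x, ∃ P : X, ∃ c : ℂ, c ≠ 0 ∧ (∀ y, (M x⁻¹ *ᵥ y) o = c * y P) ∧
      M x *ᵥ Pi.single o 1 = c⁻¹ • Pi.single P 1)
    (htrans : ∀ P, ∃ x, M x *ᵥ Pi.single o 1 = Pi.single P 1)
    (hB : ∀ x, x ∈ B ↔ M x o o ≠ 0)

include hmono htrans hB in
lemma card_eq_card_mul_card_of_monomial [Finite G] : Nat.card G = Fintype.card X * Nat.card B := by
  obtain ⟨π, -, hπ⟩ := exists_fiber_map_of_monomial M o B hmono htrans hB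
  rw [← Nat.card_congr (Equiv.sigmaFiberEquiv π), Nat.card_sigma]
  simp [hπ]

include hmono htrans hB in
lemma inducedCharacter_eq_trace_of_monomial [Finite G] (τ : B →* ℂˣ)
    (hτ : ∀ b : B, (τ b : ℂ) = M b o o) (g : G) : inducedCharacter B τ g = (M g).trace := by
  classical
  obtain ⟨π, hπM, hπ⟩ := exists_fiber_map_of_monomial M o B hmono htrans hB
  have := Fintype.ofFinite G
  have hterm : ∀ x : G, (if h : x⁻¹ * g * x ∈ B then (τ ⟨x⁻¹ * g * x, h⟩ : ℂ) else 0) =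
      M g (π x) (π x) := fun x => by
    rw [← hπM]
    split_ifs with h
    · exact hτ _
    · rw [hB, not_not] at h
      exact h.symm
  have hcard : (Nat.card B : ℂ) ≠ 0 := Nat.cast_ne_zero.mpr Nat.card_pos.ne'
  rw [inducedCharacter, finsum_eq_sum_of_fintype, inv_mul_eq_iff_eq_mul₀ hcard, trace]
  calc _ = ∑ x, M g (π x) (π x) := Finset.sum_congr rfl fun x _ => by convert hterm x
    _ = ∑ P, ∑ _x : {x // π x = P}, M g P P := (Fintype.sum_fiberwise' π fun P => M g P P).symm
    _ = _ := by
      rw [Finset.mul_sum]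
      refine Finset.sum_congr rfl fun P _ => ?_
      rw [Finset.sum_const, Finset.card_univ, ← Nat.card_eq_fintype_card, hπ, nsmul_eq_mul, diag]

include hmono hB in
/-- The linear character of `B` by which it acts on the base line. -/
lemma exists_character_of_monomial : ∃ τ : B →* ℂˣ, ∀ b : B, (τ b : ℂ) = M b o o := by
  let f : B →* ℂ :=
    { toFun := fun b => M b o o
      map_one' := by simp
      map_mul' := fun b b' => by
        have hcol : ∀ x ∈ B, M x *ᵥ Pi.single o 1 = M x o o • Pi.single o 1 := fun x hx => by
          obtain ⟨P, c, hc, -, hcol⟩ := hmono x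
          have he : M x o o = (M x *ᵥ Pi.single o 1) o := by rw [mulVec_single_one, col_apply]
          have hx := (hB x).mp hx
          rw [he, hcol] at hx ⊢
          obtain rfl : P = o := by
            by_contra hne
            exact hx (by simp [Ne.symm hne])
          simp
        have := hcol _ (b * b').2
        rw [Subgroup.coe_mul, map_mul, ← mulVec_mulVec, hcol _ b'.2, mulVec_smul, hcol _ b.2,
          smul_smul, ← map_mul] at this
        have := congrFun this o
        simp only [Pi.smul_apply, Pi.single_eq_same, smul_eq_mul, mul_one] at this
        rw [Subgroup.coe_mul, ← this, mul_comm] }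
  exact ⟨f.toHomUnits, fun b => rfl⟩

end InducedCharacter

/-! ### Cubic characters -/

section CubicCharacters

variable {F : Type*} [Field F] {K : Type*} [Field K]

lemma map_neg_one_of_pow_three {ω : MulChar F K} (hω : ω ^ 3 = 1) : ω (-1) = 1 := by
  have h3 := mulChar_pow_three hω (neg_ne_zero.mpr (one_ne_zero (α := F)))
  have h2 : ω (-1) ^ 2 = 1 := by rw [← map_pow, neg_one_sq, map_one]
  linear_combination h3 - ω (-1) * h2

lemma ringHomComp_pow_three (ω : MulChar F K) {L : Type*} [Field L] (j : K →+* L) (h : ω ^ 3 = 1) :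
    ω.ringHomComp j ^ 3 = 1 := by
  rw [MulChar.ringHomComp_pow, h, MulChar.ringHomComp_one]

lemma ringHomComp_ne_one_of_ne_one (ω : MulChar F K) {L : Type*} [Field L] (j : K →+* L)
    (h : ω ≠ 1) :
    ω.ringHomComp j ≠ 1 := by
  obtain ⟨a, ha⟩ := MulChar.ne_one_iff.mp h
  exact MulChar.ne_one_iff.mpr ⟨a, fun h1 => ha (j.injective (by simpa using h1))⟩

lemma inv_apply_eq_sq {ω : MulChar F K} (hω : ω ^ 3 = 1) (a : F) : ω⁻¹ a = ω a ^ 2 := by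
  rw [← MulChar.pow_apply' ω two_ne_zero]
  congr 1
  rw [inv_eq_iff_mul_eq_one, ← pow_succ', hω]

lemma eq_or_eq_inv_of_pow_three [Finite F] {ω χ : MulChar F K} (hω : ω ^ 3 = 1) (hχ : χ ^ 3 = 1)
    (hω1 : ω ≠ 1) (hχ1 : χ ≠ 1) : ω = χ ∨ ω = χ⁻¹ := by
  obtain ⟨g, hg⟩ := IsCyclic.exists_generator (α := Fˣ)
  have hne : ∀ ψ : MulChar F K, ψ ≠ 1 → ψ g - 1 ≠ 0 := fun ψ hψ h => hψ <| by
    rw [MulChar.eq_iff hg, MulChar.one_apply_coe]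
    exact sub_eq_zero.mp h
  have hquad : ∀ ψ : MulChar F K, ψ ^ 3 = 1 → ψ ≠ 1 → ψ g ^ 2 + ψ g + 1 = 0 := fun ψ hψ hψ1 => by
    have := mulChar_pow_three hψ g.ne_zero
    exact (mul_eq_zero.mp (by linear_combination this :
      (ψ g - 1) * (ψ g ^ 2 + ψ g + 1) = 0)).resolve_left (hne ψ hψ1)
  have h1 := hquad ω hω hω1
  have h2 := hquad χ hχ hχ1
  have : (ω g - χ g) * (ω g - χ g ^ 2) = 0 := by
    linear_combination h1 - (ω g - χ g + 1) * h2
  rw [MulChar.eq_iff hg, MulChar.eq_iff hg, inv_apply_eq_sq hχ]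
  exact (mul_eq_zero.mp this).imp sub_eq_zero.mp sub_eq_zero.mp

variable [DecidableEq F] [Fintype F]

lemma principalSeries_apply_eq_zero_or_pow_three (ω : MulChar F K) (hω : ω ^ 3 = 1)
    (g : ProjGenLinGroup (Fin 2) F) (P Q : Option F) :
    principalSeries ω hω g P Q = 0 ∨ principalSeries ω hω g P Q ^ 3 = 1 := by
  induction g using ProjGenLinGroup.induction_on with | mk g =>
  rw [principalSeries_mk, principalSeriesGL_apply]
  rcases eq_or_ne (lineCoord ω ((g⁻¹ : GL (Fin 2) F).1 *ᵥ lineRep P) Q) 0 with h | h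
  · exact .inl (by rw [h, mul_zero])
  · right
    rw [mul_pow, mulChar_pow_three (inv_pow_three hω) (c := g.1.det) g.det.ne_zero, one_mul]
    obtain ⟨c, hc⟩ := exists_smul_of_lineCoord_ne_zero h
    rw [hc, lineCoord_smul_lineRep, if_pos rfl] at h ⊢
    exact mulChar_pow_three hω fun h0 => h (by rw [h0, MulChar.map_zero])

/-- The intertwining operator shows that the principal series of `ω` and `ω⁻¹` have the same
character. -/
lemma trace_principalSeries_inv (ω : MulChar F K) (hω : ω ^ 3 = 1) (hω1 : ω ≠ 1)
    (hq : (Fintype.card F : K) ≠ 0) (g : ProjGenLinGroup (Fin 2) F) :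
    (principalSeries ω⁻¹ (inv_pow_three hω) g).trace = (principalSeries ω hω g).trace := by
  have h1 := intertwiner_mul_inv ω hω1 (map_neg_one_of_pow_three hω)
  have h2 := intertwiner_mul_inv ω⁻¹ (inv_ne_one.mpr hω1)
    (map_neg_one_of_pow_three (inv_pow_three hω))
  rw [inv_inv] at h2
  refine mul_left_cancel₀ hq ?_
  calc _ = (principalSeries ω⁻¹ (inv_pow_three hω) g *
            (intertwiner ω⁻¹ * intertwiner ω)).trace := by
        rw [h2, Matrix.mul_smul, Matrix.mul_one, trace_smul, smul_eq_mul]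
    _ = ((intertwiner ω * principalSeries ω⁻¹ (inv_pow_three hω) g) * intertwiner ω⁻¹).trace := by
        rw [← Matrix.mul_assoc, trace_mul_comm, Matrix.mul_assoc]
    _ = _ := by
        rw [← principalSeries_mul_intertwiner ω hω g, Matrix.mul_assoc, h1, Matrix.mul_smul,
          Matrix.mul_one, trace_smul, smul_eq_mul]

/-- The principal series of a cubic character over the field with four elements has an `𝔽₂`-form
preserving a nondegenerate alternating form. -/
lemma exists_symplectic_form_principalSeries [Algebra (ZMod 2) K] [CharP K 2] [Finite K]
    (hK : Module.finrank (ZMod 2) K = 2) (ω : MulChar F K) (hω : ω ^ 3 = 1) (hω1 : ω ≠ 1) {n : ℕ}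
    (hn : Fintype.card F + 1 = 2 * n) :
    ∃ (φ : ProjGenLinGroup (Fin 2) F →* symplecticGroup (Fin n) (ZMod 2))
      (P : Matrix (Option F) (Fin n ⊕ Fin n) K) (P' : Matrix (Fin n ⊕ Fin n) (Option F) K),
      P * P' = 1 ∧ P' * P = 1 ∧
      ∀ g, (φ g).1.map (algebraMap (ZMod 2) K) = P' * principalSeries ω hω g * P := by
  have hneg := map_neg_one_of_pow_three hω
  have hfrob : ∀ a, (frobenius K 2) (ω a) = ω⁻¹ a := fun a => (inv_apply_eq_sq hω a).symm
  have hT : (intertwiner ω).map (frobenius K 2) = intertwiner ω⁻¹ :=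
    intertwiner_map ω ω⁻¹ (frobenius K 2) hfrob
  have hM : ∀ g, (principalSeries ω hω g).map (frobenius K 2) =
      principalSeries ω⁻¹ (inv_pow_three hω) g :=
    principalSeries_map ω ω⁻¹ hω (inv_pow_three hω) (frobenius K 2) hfrob
  have hodd : (Fintype.card F : K) = 1 := by
    have h2 : (2 : K) = 0 := CharTwo.two_eq_zero
    have := congrArg (Nat.cast (R := K)) hn
    push_cast at this
    linear_combination this + (n - 1) * h2
  refine exists_symplectic_descent hK (T := intertwiner ω) (intertwiner_transpose ω hneg)
    (intertwiner_apply_self ω) ?_ (by rw [Fintype.card_option, hn]) (principalSeries ω hω)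
    (fun g => by rw [hM, principalSeries_mul_intertwiner]) fun g => ?_
  · rw [hT, intertwiner_mul_inv ω hω1 hneg, hodd, one_smul]
  · have h := principalSeries_mul_intertwiner ω⁻¹ (inv_pow_three hω) g
    simp only [inv_inv] at h
    rw [hT, principalSeries_transpose, Matrix.mul_assoc, ← h, ← Matrix.mul_assoc, ← map_mul,
      inv_mul_cancel, map_one, Matrix.one_mul]

end CubicCharacters

/-! ### Properties of the form over the prime field -/

section Reduction

lemma baseChange_apply {G : Type*} [Group G] {ι : Type*} [Fintype ι] [DecidableEq ι] {k : Type*}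
    [Field k] (K : Type*) [Field K] [Algebra k K] (ρ : G →* Matrix ι ι k) (g : G) :
    baseChange K ρ g = (ρ g).map (algebraMap k K) := rfl

variable {F : Type*} [Field F] [DecidableEq F] [Fintype F] {ι : Type*} [Fintype ι] [DecidableEq ι]
  {k : Type} [Field k] [Algebra (ZMod 2) k] (ω : MulChar F k) (hω : ω ^ 3 = 1)
  (ρ : ProjGenLinGroup (Fin 2) F →* Matrix ι ι (ZMod 2))
  {P : Matrix (Option F) ι k} {P' : Matrix ι (Option F) k} (hPP' : P * P' = 1) (hP'P : P' * P = 1)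
  (hρ : ∀ g, (ρ g).map (algebraMap (ZMod 2) k) = P' * principalSeries ω hω g * P)

include hρ in
lemma map_algebraMap_eq_conj_principalSeries {L : Type*} [Field L] [Algebra (ZMod 2) L]
    (j : k →ₐ[ZMod 2] L) (hω' : ω.ringHomComp (j : k →+* L) ^ 3 = 1)
    (g : ProjGenLinGroup (Fin 2) F) :
    (ρ g).map (algebraMap (ZMod 2) L) =
      P'.map j * principalSeries (ω.ringHomComp (j : k →+* L)) hω' g * P.map j := by
  have h1 : (ρ g).map (algebraMap (ZMod 2) L) = ((ρ g).map (algebraMap (ZMod 2) k)).map j := by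
    ext a b
    simp
  have h2 : (principalSeries ω hω g).map j = principalSeries (ω.ringHomComp (j : k →+* L)) hω' g :=
    principalSeries_map ω _ hω hω' j (fun a => rfl) g
  rw [h1, hρ, Matrix.map_mul, Matrix.map_mul, h2]

include hPP' hP'P hρ in
lemma isAbsolutelyIrreducible_of_conj_principalSeries [Algebra.IsAlgebraic (ZMod 2) k]
    (hω1 : ω ≠ 1) (hodd : Odd (Fintype.card F)) : IsAbsolutelyIrreducible ρ := by
  intro K _ _
  let L := AlgebraicClosure K
  have : CharP L 2 := charP_of_injective_algebraMap (algebraMap (ZMod 2) L).injective 2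
  let j : k →ₐ[ZMod 2] L := IsAlgClosed.lift
  have hω' := ringHomComp_pow_three ω (j : k →+* L) hω
  have hQQ' : P.map j * P'.map j = 1 := by
    rw [← Matrix.map_mul, hPP', Matrix.map_one _ (map_zero j) (map_one j)]
  have hQ'Q : P'.map j * P.map j = 1 := by
    rw [← Matrix.map_mul, hP'P, Matrix.map_one _ (map_zero j) (map_one j)]
  have hq : (Fintype.card F : L) ≠ 0 := by
    rw [Ne, CharP.cast_eq_zero_iff L 2]
    exact fun h => (Nat.not_even_iff_odd.mpr hodd) (even_iff_two_dvd.mpr h)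
  have : Nonempty ι := by
    by_contra h
    rw [not_nonempty_iff] at h
    have := congrFun (congrFun hPP' none) none
    simp [mul_apply] at this
  refine isIrreducible_of_forall_exists_dotProduct_ne_zero _ fun v a hv ha => ?_
  -- pass to the algebraic closure and to the coordinates of the principal series
  have hmap : ∀ x : ι → K, x ≠ 0 → algebraMap K L ∘ x ≠ 0 := fun x hx h => hx <| funext fun i =>
    (algebraMap K L).injective <| by simpa using congrFun h i
  have hv' : P.map j *ᵥ (algebraMap K L ∘ v) ≠ 0 := fun h => hmap v hv <| by
    rw [← one_mulVec (algebraMap K L ∘ v), ← hQ'Q, ← mulVec_mulVec, h, mulVec_zero]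
  have ha' : (algebraMap K L ∘ a) ᵥ* P'.map j ≠ 0 := fun h => hmap a ha <| by
    rw [← vecMul_one (algebraMap K L ∘ a), ← hQ'Q, ← vecMul_vecMul, h, zero_vecMul]
  obtain ⟨s, hs⟩ := exists_principalSeries_coeff_ne_zero (ω.ringHomComp (j : k →+* L)) hω'
    (ringHomComp_ne_one_of_ne_one ω _ hω1) hq hv' ha'
  refine ⟨ProjGenLinGroup.mk (SpecialLinearGroup.toGL s), fun h => hs ?_⟩
  have h2 := congrArg (algebraMap K L) h
  have h3 : (baseChange K ρ (ProjGenLinGroup.mk (SpecialLinearGroup.toGL s))).map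
      (algebraMap K L) = (ρ (ProjGenLinGroup.mk (SpecialLinearGroup.toGL s))).map
      (algebraMap (ZMod 2) L) := by
    ext x y
    rw [baseChange_apply, map_apply, map_apply, map_apply, ← IsScalarTower.algebraMap_apply]
  have h4 : algebraMap K L ∘
      (baseChange K ρ (ProjGenLinGroup.mk (SpecialLinearGroup.toGL s)) *ᵥ v) =
      (baseChange K ρ (ProjGenLinGroup.mk (SpecialLinearGroup.toGL s))).map (algebraMap K L) *ᵥ
        (algebraMap K L ∘ v) := funext fun i => RingHom.map_mulVec _ _ v i
  rw [RingHom.map_dotProduct, h4, h3, map_zero,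
    map_algebraMap_eq_conj_principalSeries ω hω ρ hρ j hω', ← mulVec_mulVec, ← mulVec_mulVec,
    dotProduct_mulVec] at h2
  exact h2

include hPP' hP'P hρ in
lemma isUnisingular_of_conj_principalSeries : IsUnisingular ρ := by
  intro g
  apply (algebraMap (ZMod 2) k).injective
  rw [RingHom.map_det, map_zero, map_sub, map_one]
  have h : (algebraMap (ZMod 2) k).mapMatrix (ρ g) - 1 = P' * (principalSeries ω hω g - 1) * P := by
    rw [Matrix.mul_sub, Matrix.sub_mul, Matrix.mul_one, hP'P, ← hρ]
    rfl
  rw [h, det_conj_of_mul_eq_one hP'P hPP', det_principalSeries_sub_one]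

include hPP' hP'P hρ in
/-- On elements of odd order the Brauer character is the trace of the complex principal series of
the lifted character. -/
lemma brauerCharacter_eq_trace_principalSeries [Algebra.IsAlgebraic (ZMod 2) k] (hω1 : ω ≠ 1)
    (θ : AlgebraicClosure (ZMod 2) →*₀ ℂ) (hθ : Function.Injective θ) :
    ∃ (χ : MulChar F ℂ) (hχ : χ ^ 3 = 1), χ ≠ 1 ∧ ∀ g, Odd (orderOf g) →
      brauerCharacter θ ρ g = (principalSeries χ hχ g).trace := by
  let Ω := AlgebraicClosure (ZMod 2)
  have : CharP Ω 2 := charP_of_injective_algebraMap (algebraMap (ZMod 2) Ω).injective 2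
  let j : k →ₐ[ZMod 2] Ω := IsAlgClosed.lift
  set ω' := ω.ringHomComp (j : k →+* Ω) with hω'_def
  have hω' : ω' ^ 3 = 1 := ringHomComp_pow_three ω (j : k →+* Ω) hω
  have hω'1 : ω' ≠ 1 := ringHomComp_ne_one_of_ne_one ω _ hω1
  let χ : MulChar F ℂ :=
    { toMonoidHom := (θ : Ω →* ℂ).comp ω'.toMonoidHom
      map_nonunit' := fun a ha => by
        change θ (ω' a) = 0
        rw [MulChar.map_nonunit ω' ha, map_zero] }
  have hχa : ∀ a, θ (ω' a) = χ a := fun a => rfl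
  have hχ : χ ^ 3 = 1 := by
    ext a
    rw [MulChar.pow_apply_coe, ← hχa, ← map_pow, mulChar_pow_three hω' a.ne_zero, map_one,
      MulChar.one_apply_coe]
  refine ⟨χ, hχ, fun h => hω'1 ?_, fun g hg => ?_⟩
  · ext a
    rw [MulChar.one_apply_coe]
    apply hθ
    rw [hχa, h, MulChar.one_apply_coe, map_one]
  · have hQQ' : P.map j * P'.map j = 1 := by
      rw [← Matrix.map_mul, hPP', Matrix.map_one _ (map_zero j) (map_one j)]
    have hcard : Fintype.card (Option F) = Fintype.card ι := by
      have h1 := rank_mul_le_left P P'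
      have h2 := rank_mul_le_left P' P
      rw [hPP', rank_one] at h1
      rw [hP'P, rank_one] at h2
      exact le_antisymm (h1.trans (rank_le_card_width P)) (h2.trans (rank_le_card_width P'))
    have hm : Odd (3 * orderOf g) := Nat.odd_mul.mpr ⟨by decide, hg⟩
    have : NeZero (3 * orderOf g) := ⟨hm.pos.ne'⟩
    have : NeZero ((3 * orderOf g : ℕ) : Ω) := ⟨by
      rw [Ne, CharP.cast_eq_zero_iff Ω 2]
      exact fun h => (Nat.not_even_iff_odd.mpr hm) (even_iff_two_dvd.mpr h)⟩
    obtain ⟨z, hz⟩ := HasEnoughRootsOfUnity.exists_primitiveRoot Ω (3 * orderOf g)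
    have hmap : (principalSeries ω' hω' g).map θ = principalSeries χ hχ g :=
      principalSeries_map ω' χ hω' hχ θ hχa g
    rw [brauerCharacter, baseChange_apply,
      map_algebraMap_eq_conj_principalSeries ω hω ρ hρ j hω',
      charpoly_conj_of_mul_eq_one hQQ' hcard, ← hmap]
    refine sum_map_roots_charpoly_eq_trace θ hθ hz _ (fun x y => ?_) ?_
    · refine (principalSeries_apply_eq_zero_or_pow_three ω' hω' g x y).imp_right fun h => ?_
      rw [pow_mul, h, one_pow]
    · rw [hmap, ← map_pow, mul_comm, pow_mul, pow_orderOf_eq_one, one_pow, map_one]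

end Reduction

/-! ### The complex principal series of `PSL₂(F)` -/

section ProjectiveSpecialLinear

variable {F : Type*} [Field F]

/-- If `-1` is not a square, then the Borel subgroup of `PSL₂(F)` has odd order: the square of an
upper triangular matrix of determinant one is `± 1` only if the matrix itself is. -/
lemma odd_card_borelPSL [Finite F] (hF : ∀ a : F, a ^ 2 ≠ -1) : Odd (Nat.card (borelPSL F)) := by
  rw [← Nat.not_even_iff_odd, even_iff_two_dvd]
  intro h
  obtain ⟨⟨x, hx⟩, hx2⟩ := exists_prime_orderOf_dvd_card' 2 h
  rw [orderOf_eq_iff two_pos] at hx2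
  obtain ⟨hsq, hne⟩ := hx2
  obtain ⟨s, hs, rfl⟩ := hx
  have hs : s 1 0 = 0 := hs
  refine hne 1 one_lt_two one_pos (Subtype.ext ?_)
  rw [pow_one]
  change (QuotientGroup.mk s : ProjectiveSpecialLinearGroup (Fin 2) F) = 1
  have hsq' : (QuotientGroup.mk (s ^ 2) : ProjectiveSpecialLinearGroup (Fin 2) F) = 1 :=
    congrArg Subtype.val hsq
  rw [QuotientGroup.eq_one_iff, Matrix.SpecialLinearGroup.mem_center_iff] at hsq' ⊢
  obtain ⟨r, hr, hrs⟩ := hsq'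
  have hr : r ^ 2 = 1 := by simpa using hr
  have hdet : s 0 0 * s 1 1 = 1 := by
    have := s.2
    rw [det_fin_two] at this
    linear_combination this + s 0 1 * hs
  have e00 := congrFun (congrFun hrs 0) 0
  have e01 := congrFun (congrFun hrs 0) 1
  have e11 := congrFun (congrFun hrs 1) 1
  simp [pow_two, mul_apply, hs] at e00 e01 e11
  have hr1 : r = 1 := by
    rcases mul_self_eq_one_iff.mp ((pow_two r).symm.trans hr) with h | h
    · exact h
    · exact absurd (by rw [pow_two, ← e00, h]) (hF (s 0 0))
  subst hr1
  have h11 : s 1 1 = s 0 0 := by linear_combination s 1 1 * e00 + s 0 0 * hdet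
  have h2 : (2 : F) ≠ 0 := fun h2 => hF 1 (by linear_combination h2)
  have h00 : s 0 0 ≠ 0 := left_ne_zero_of_mul_eq_one hdet
  have h01 : s 0 1 = 0 := by
    have : 2 * s 0 0 * s 0 1 = 0 := by linear_combination -e01 - s 0 1 * h11
    exact (mul_eq_zero.mp this).resolve_left (mul_ne_zero h2 h00)
  refine ⟨s 0 0, by simp [pow_two, ← e00], ?_⟩
  ext i j
  fin_cases i <;> fin_cases j <;> simp [h01, hs, h11]

lemma exists_smul_lineRep_specialLinearGroup (s : SpecialLinearGroup (Fin 2) F) (P : Option F) :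
    ∃ (c : F) (R : Option F), c ≠ 0 ∧ s.1 *ᵥ lineRep P = c • lineRep R := by
  refine exists_smul_lineRep fun h => lineRep_ne_zero P ?_
  have hs : (s⁻¹).1 * s.1 = 1 := congrArg Subtype.val (inv_mul_cancel s)
  rw [← one_mulVec (lineRep P), ← hs, ← mulVec_mulVec, h, mulVec_zero]

variable [DecidableEq F] [Fintype F] (χ : MulChar F ℂ) (hχ : χ ^ 3 = 1)

/-- The restriction to `PSL₂(F)` of the complex principal series of a cubic character. -/
noncomputable def complexPrincipalSeries :
    ProjectiveSpecialLinearGroup (Fin 2) F →* Matrix (Option F) (Option F) ℂ :=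
  (principalSeries χ hχ).comp ProjectiveSpecialLinearGroup.toPGL

lemma complexPrincipalSeries_monomial (x : ProjectiveSpecialLinearGroup (Fin 2) F) :
    ∃ P : Option F, ∃ c : ℂ, c ≠ 0 ∧
      (∀ y, (complexPrincipalSeries χ hχ x⁻¹ *ᵥ y) none = c * y P) ∧
      complexPrincipalSeries χ hχ x *ᵥ Pi.single none 1 = c⁻¹ • Pi.single P 1 := by
  obtain ⟨s, rfl⟩ := QuotientGroup.mk_surjective x
  obtain ⟨d, P, hd, hP⟩ := exists_smul_lineRep_specialLinearGroup s none
  exact ⟨P, χ d, MulChar.apply_ne_zero_iff.mpr hd.isUnit,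
    fun y => principalSeries_inv_mulVec_apply χ hχ s y hP, principalSeries_mulVec_single χ hχ s hP⟩

lemma complexPrincipalSeries_transitive (P : Option F) :
    ∃ x, complexPrincipalSeries χ hχ x *ᵥ Pi.single none 1 = Pi.single P 1 := by
  obtain ⟨s, hs⟩ := exists_specialLinearGroup_mulVec_lineRep P
  refine ⟨QuotientGroup.mk s, ?_⟩
  have := principalSeries_mulVec_single χ hχ s (hs.trans (one_smul F _).symm)
  rwa [map_one, inv_one, one_smul] at this

lemma complexPrincipalSeries_mk_apply_none (s : SpecialLinearGroup (Fin 2) F) :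
    complexPrincipalSeries χ hχ (QuotientGroup.mk s) none none =
      if s 1 0 = 0 then (χ (s 0 0))⁻¹ else 0 := by
  obtain ⟨d, P, hd, hP⟩ := exists_smul_lineRep_specialLinearGroup s none
  have h := congrFun (principalSeries_mulVec_single χ hχ s hP) none
  rw [mulVec_single_one, col_apply] at h
  have h0 := congrFun hP 0
  have h1 := congrFun hP 1
  refine h.trans ?_
  cases P with
  | none =>
    simp [lineRep, mulVec, dotProduct, Fin.sum_univ_two] at h0 h1
    simp [h0, h1]
  | some p =>
    simp [lineRep, mulVec, dotProduct, Fin.sum_univ_two] at h0 h1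
    simp [h1, hd]

lemma mem_borelPSL_iff (x : ProjectiveSpecialLinearGroup (Fin 2) F) :
    x ∈ borelPSL F ↔ complexPrincipalSeries χ hχ x none none ≠ 0 := by
  constructor
  · rintro ⟨s, hs, rfl⟩
    have hs : s 1 0 = 0 := hs
    have hdet : s 0 0 * s 1 1 = 1 := by
      have := s.2
      rw [det_fin_two] at this
      linear_combination this + s 0 1 * hs
    rw [QuotientGroup.mk'_apply, complexPrincipalSeries_mk_apply_none, if_pos hs]
    exact inv_ne_zero (MulChar.apply_ne_zero_iff.mpr (left_ne_zero_of_mul_eq_one hdet).isUnit)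
  · obtain ⟨s, rfl⟩ := QuotientGroup.mk_surjective x
    rw [complexPrincipalSeries_mk_apply_none]
    intro h
    exact ⟨s, by by_contra hs; exact h (if_neg hs), rfl⟩

/-- The principal series of a nontrivial cubic character is induced from a character of order three
of the Borel subgroup. -/
lemma exists_orderOf_eq_three_inducedCharacter (hχ1 : χ ≠ 1) :
    ∃ τ : borelPSL F →* ℂˣ, orderOf τ = 3 ∧
      ∀ g, inducedCharacter (borelPSL F) τ g = (complexPrincipalSeries χ hχ g).trace := by
  obtain ⟨τ, hτ⟩ := exists_character_of_monomial (complexPrincipalSeries χ hχ) none (borelPSL F)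
    (complexPrincipalSeries_monomial χ hχ) (mem_borelPSL_iff χ hχ)
  have : Fact (Nat.Prime 3) := ⟨Nat.prime_three⟩
  refine ⟨τ, orderOf_eq_prime ?_ ?_, inducedCharacter_eq_trace_of_monomial _ none _
    (complexPrincipalSeries_monomial χ hχ) (complexPrincipalSeries_transitive χ hχ)
    (mem_borelPSL_iff χ hχ) τ hτ⟩
  · ext b
    have hb := (mem_borelPSL_iff χ hχ b.1).mp b.2
    rw [MonoidHom.pow_apply, Units.val_pow_eq_pow_val, hτ]
    exact (principalSeries_apply_eq_zero_or_pow_three χ hχ _ none none).resolve_left hb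
  · obtain ⟨a, ha⟩ := MulChar.ne_one_iff.mp hχ1
    let s : SpecialLinearGroup (Fin 2) F :=
      ⟨!![(a : F), 0; 0, (a : F)⁻¹], by simp [det_fin_two]⟩
    have hs : s 1 0 = 0 := rfl
    intro h1
    have h := hτ ⟨QuotientGroup.mk s, ⟨s, hs, rfl⟩⟩
    rw [complexPrincipalSeries_mk_apply_none, if_pos hs, h1] at h
    exact ha (inv_eq_one.mp h.symm)

lemma isIrreducibleCharacterOfDegree_trace {G : Type*} [Group G] {X : Type*} [Fintype X]
    [DecidableEq X] [Nonempty X] (M : G →* Matrix X X ℂ)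
    (hM : ∀ v a : X → ℂ, v ≠ 0 → a ≠ 0 → ∃ g, a ⬝ᵥ M g *ᵥ v ≠ 0) :
    IsIrreducibleCharacterOfDegree (fun g => (M g).trace) (Fintype.card X) := by
  let e := Fintype.equivFin X
  let N : G →* Matrix (Fin (Fintype.card X)) (Fin (Fintype.card X)) ℂ :=
    ((reindexAlgEquiv ℂ ℂ e : Matrix X X ℂ ≃ₐ[ℂ] _) : Matrix X X ℂ →* _).comp M
  have hN : ∀ g, N g = (M g).submatrix e.symm e.symm := fun g => rfl
  have : Nonempty (Fin (Fintype.card X)) := ⟨e (Classical.arbitrary X)⟩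
  have hcomp : ∀ v : Fin (Fintype.card X) → ℂ, v ≠ 0 → v ∘ e ≠ 0 := fun v hv h =>
    hv <| funext fun i => by simpa using congrFun h (e.symm i)
  refine ⟨toRepresentation N, isIrreducible_of_forall_exists_dotProduct_ne_zero N
    fun v a hv ha => ?_, fun g => ?_⟩
  · obtain ⟨g, hg⟩ := hM (v ∘ e) (a ∘ e) (hcomp v hv) (hcomp a ha)
    refine ⟨g, ?_⟩
    rw [hN, submatrix_mulVec_equiv, Equiv.symm_symm, dotProduct_comp_equiv_symm]
    exact hg
  · change LinearMap.trace ℂ _ (Matrix.toLin' (N g)) = _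
    rw [trace_toLin'_eq, hN]
    exact Equiv.sum_comp e.symm fun i => M g i i

/-- The complex principal series of a nontrivial cubic character is irreducible for `PSL₂(F)`, and
it is of `2`-defect zero because the Borel subgroup has odd order. -/
lemma isDefectZeroCharacter_complexPrincipalSeries (hχ1 : χ ≠ 1) (hF : ∀ a : F, a ^ 2 ≠ -1) :
    IsDefectZeroCharacter 2 fun g => (complexPrincipalSeries χ hχ g).trace := by
  refine ⟨Fintype.card (Option F), isIrreducibleCharacterOfDegree_trace _ fun v a hv ha => ?_, ?_⟩
  · obtain ⟨g, hg⟩ := exists_principalSeries_coeff_ne_zero χ hχ hχ1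
      (Nat.cast_ne_zero.mpr Fintype.card_ne_zero) hv ha
    exact ⟨QuotientGroup.mk g, hg⟩
  · have hcard := card_eq_card_mul_card_of_monomial (complexPrincipalSeries χ hχ) none (borelPSL F)
      (complexPrincipalSeries_monomial χ hχ) (complexPrincipalSeries_transitive χ hχ)
      (mem_borelPSL_iff χ hχ)
    have hdvd := Nat.ordProj_dvd (Nat.card (ProjectiveSpecialLinearGroup (Fin 2) F)) 2
    conv_rhs at hdvd => rw [hcard]
    exact (Nat.Coprime.pow_left _ (odd_card_borelPSL hF).coprime_two_left).dvd_of_dvd_mul_right hdvd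

end ProjectiveSpecialLinear

end Unisingular

open Unisingular in
theorem mainTheorem4 (F : Type*) [Field F] [Fintype F] (q : ℕ) (hq : Fintype.card F = q)
    (h4 : 4 ∣ q + 1) (h3 : 3 ∣ q - 1) :
    ∃ φ : Matrix.ProjGenLinGroup (Fin 2) F →*
        Matrix.symplecticGroup (Fin ((q + 1) / 2)) (ZMod 2),
      Unisingular.IsAbsolutelyIrreducible ((Submonoid.subtype _).comp φ) ∧
      Unisingular.IsUnisingular ((Submonoid.subtype _).comp φ) ∧
      ∃ τ : Unisingular.borelPSL F →* ℂˣ,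
        orderOf τ = 3 ∧
        Unisingular.IsDefectZeroCharacter 2
          (Unisingular.inducedCharacter (Unisingular.borelPSL F) τ) ∧
        ∀ θ : AlgebraicClosure (ZMod 2) →*₀ ℂ, Function.Injective θ →
          ∀ g : Matrix.ProjectiveSpecialLinearGroup (Fin 2) F, Odd (orderOf g) →
            Unisingular.brauerCharacter θ ((Submonoid.subtype _).comp φ)
                (Matrix.ProjectiveSpecialLinearGroup.toPGL g) =
              Unisingular.inducedCharacter (Unisingular.borelPSL F) τ g := by
  classical
  subst hq
  have hcube : ∀ {K : Type} [Field K] {ω : MulChar F K}, orderOf ω = 3 → ω ^ 3 = 1 ∧ ω ≠ 1 := by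
    intro K _ ω h
    refine ⟨h ▸ pow_orderOf_eq_one ω, ?_⟩
    rintro rfl
    simp at h
  have hF : ∀ a : F, a ^ 2 ≠ -1 := fun a ha => by
    have := FiniteField.isSquare_neg_one_iff.mp ⟨a, by rw [← ha, pow_two]⟩
    omega
  -- a cubic character with values in the field with four elements
  have hfin : Module.finrank (ZMod 2) (GaloisField 2 2) = 2 := GaloisField.finrank 2 two_ne_zero
  obtain ⟨z, hz⟩ := exists_sq_eq_add_one hfin
  have h2 : (2 : GaloisField 2 2) = 0 := CharTwo.two_eq_zero
  have : Fact (Nat.Prime 3) := ⟨Nat.prime_three⟩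
  have hz3 : orderOf z = 3 := orderOf_eq_prime (by linear_combination (z + 1) * hz + z * h2) <| by
    rintro rfl
    exact one_ne_zero (α := GaloisField 2 2) (by linear_combination -hz)
  obtain ⟨ω, hω⟩ := MulChar.exists_mulChar_orderOf F h3 (hz3 ▸ IsPrimitiveRoot.orderOf z)
  obtain ⟨hω3, hω1⟩ := hcube hω
  obtain ⟨φ, P, P', hPP', hP'P, hφ⟩ := exists_symplectic_form_principalSeries hfin ω hω3 hω1
    (n := (Fintype.card F + 1) / 2) (by omega)
  -- a complex cubic character
  obtain ⟨χ, hχ⟩ := MulChar.exists_mulChar_orderOf F h3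
    (Complex.isPrimitiveRoot_exp 3 three_ne_zero)
  obtain ⟨hχ3, hχ1⟩ := hcube hχ
  obtain ⟨τ, hτ, hind⟩ := exists_orderOf_eq_three_inducedCharacter χ hχ3 hχ1
  refine ⟨φ, isAbsolutelyIrreducible_of_conj_principalSeries ω hω3 _ hPP' hP'P hφ hω1
    (by rw [Nat.odd_iff]; omega), isUnisingular_of_conj_principalSeries ω hω3 _ hPP' hP'P hφ,
    τ, hτ, ?_, fun θ hθ g hg => ?_⟩
  · rw [funext hind]
    exact isDefectZeroCharacter_complexPrincipalSeries χ hχ3 hχ1 hF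
  · obtain ⟨χ', hχ'3, hχ'1, hbr⟩ := brauerCharacter_eq_trace_principalSeries ω hω3
      ((Submonoid.subtype _).comp φ) hPP' hP'P hφ hω1 θ hθ
    rw [hbr _ (by rwa [orderOf_injective _ Matrix.ProjectiveSpecialLinearGroup.toPGL_injective]),
      hind]
    -- `θ` may match the two cubic characters of `F` or interchange them
    rcases eq_or_eq_inv_of_pow_three hχ'3 hχ3 hχ'1 hχ1 with rfl | rfl
    · rfl
    · exact trace_principalSeries_inv χ hχ3 hχ1 (Nat.cast_ne_zero.mpr Fintype.card_ne_zero) _
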